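/- Let $M$ be a complete (finite-dimensional, smooth) Riemannian manifold and let $G$ be a Lie group acting smoothly, freely, properly and by isometries on $M$. Give the orbit space $M/G$ its quotient topology, the smooth structure for which the projection $\pi:M\to M/G$ is a submersion, and the Riemannian metric for which $\pi$ is a Riemannian submersion. Let $$\overrightarrow H_G=\sum_i\left(\nabla_{E_i}E_i\right)^{\perp}$$ be the (non-normalized) mean curvature vector field of the orbits of $G$, where $(E_i)$ is a local orthonormal frame tangent to the orbits and $\perp$ denotes the component orthogonal to the orbits. Let $a:[0,\infty)\to\mathbb R$ be continuous on $[0,\infty)$ and $C^1$ on $(0,\infty)$, with $a(s)>0$ and $a'(s)>0$ for $s>0$. Let $\Omega\subset M$ be a $G$-invariant domain of class $C^2$ and $\Lambda=\pi(\Omega)\subset M/G$. Let $u\in C^2(\Omega)\cap C^0(\overline\Omega)$ and $\varphi\in C^0(\partial\Omega)$ be $G$-invariant functions, and let $v\in C^2(\Lambda)\cap C^0(\overline\Lambda)$ and $\psi\in C^0(\partial\Lambda)$ be such that $u=v\circ\pi$ on $\overline\Omega$ and $\varphi=\psi\circ\pi$ on $\partial\Omega$. Then $\overrightarrow H_G$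 projects to a vector field $J$ on $M/G$, that is, $d\pi_p(\overrightarrow H_G(p))=J(\pi(p))$ for all $p\in M$; on $\Omega$ $$\frac{a(\|\nabla u\|)}{\|\nabla u\|}=\frac{a(\|\nabla v\|)}{\|\nabla v\|}\circ\pi ;$$ and $u$ is a solution of the Dirichlet problem $$\operatorname{div}_M\left(\frac{a(\|\nabla u\|)}{\|\nabla u\|}\nabla u\right)=0\ \text{ in }\Omega,\qquad u|_{\partial\Omega}=\varphi,$$ if and only if $v$ is a solution of the Dirichlet problem $$\operatorname{div}_{M/G}\left(\frac{a(\|\nabla v\|)}{\|\nabla v\|}\nabla v\right)-\frac{a(\|\nabla v\|)}{\|\nabla v\|}\langle\nabla v,J\rangle=0\ \text{ in }\Lambda,\qquad v|_{\partial\Lambda}=\psi .$$ Here solutions are classical: the vector field $\frac{a(\|\nabla u\|)}{\|\nabla u\|}\nabla u$, set equal to $0$ where $\nabla u=0$, is differentiable at each point of $\Omega$ and satisfies the equation at each point of $\Omega$, and likewise for $v$ on $\Lambda$. The quotient $a(\|\nabla u\|)/\|\nabla u\|$ is read as $0$ where $\nabla u=0$, and likewise for $v$. -/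

import Mathlib

open Set Filter Topology Manifold Bundle FiberBundle VectorField
open scoped ContDiff

noncomputable section

set_option linter.unusedSectionVars false

/-! ### Riemannian geometry on a finite-dimensional smooth manifold -/

section Riemannian

variable {E : Type*} [NormedAddCommGroup E] [NormedSpace ℝ E] [FiniteDimensional ℝ E]
  {M : Type*} [TopologicalSpace M] [ChartedSpace E M] [IsManifold 𝓘(ℝ, E) ∞ M]

instance tangentSpace_finiteDimensional (x : M) :
    FiniteDimensional ℝ (TangentSpace 𝓘(ℝ, E) x) :=
  inferInstanceAs (FiniteDimensional ℝ E)

theorem mdifferentiableAt_extend_tangent {x : M} (v : TangentSpace 𝓘(ℝ, E) x) :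
    MDiffAt (T% (extend E v : Π y : M, TangentSpace 𝓘(ℝ, E) y)) x :=
  mdifferentiableAt_extend 𝓘(ℝ, E) E v

variable [RiemannianBundle (fun x : M ↦ TangentSpace 𝓘(ℝ, E) x)]

instance tangentSpace_completeSpace (x : M) : CompleteSpace (TangentSpace 𝓘(ℝ, E) x) :=
  FiniteDimensional.complete ℝ _

/-- The right-hand side of the Koszul formula for `⟪∇_X Y, Z⟫` at the point `x`. -/
def koszul (X Y Z : Π x : M, TangentSpace 𝓘(ℝ, E) x) (x : M) : ℝ :=
  (1 / 2 : ℝ) *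
    (mvfderiv 𝓘(ℝ, E) (fun y ↦ inner ℝ (Y y) (Z y)) x (X x)
      + mvfderiv 𝓘(ℝ, E) (fun y ↦ inner ℝ (X y) (Z y)) x (Y x)
      - mvfderiv 𝓘(ℝ, E) (fun y ↦ inner ℝ (X y) (Y y)) x (Z x)
      + inner ℝ (mlieBracket 𝓘(ℝ, E) X Y x) (Z x)
      - inner ℝ (mlieBracket 𝓘(ℝ, E) X Z x) (Y x)
      - inner ℝ (mlieBracket 𝓘(ℝ, E) Y Z x) (X x))

variable [IsContMDiffRiemannianBundle 𝓘(ℝ, E) ∞ E (fun x : M ↦ TangentSpace 𝓘(ℝ, E) x)]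

theorem mdifferentiableAt_inner {X Y : Π x : M, TangentSpace 𝓘(ℝ, E) x} {x : M}
    (hX : MDiffAt (T% X) x) (hY : MDiffAt (T% Y) x) :
    MDiffAt (fun y ↦ inner ℝ (X y) (Y y) : M → ℝ) x :=
  MDifferentiableAt.inner_bundle (IB := 𝓘(ℝ, E)) (F := E)
    (E := fun x : M ↦ TangentSpace 𝓘(ℝ, E) x) hX hY

theorem koszul_tensorial_left {Y : Π x : M, TangentSpace 𝓘(ℝ, E) x} {x : M}
    (hY : MDiffAt (T% Y) x) (Z : Π x : M, TangentSpace 𝓘(ℝ, E) x) (hZ : MDiffAt (T% Z) x) :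
    TensorialAt 𝓘(ℝ, E) E (fun X ↦ koszul X Y Z x) x where
  smul {f X} hf hX := by
    have h1 := mvfderiv_fun_mul hf (mdifferentiableAt_inner hX hZ)
    have h2 := mvfderiv_fun_mul hf (mdifferentiableAt_inner hX hY)
    simp only [koszul, Pi.smul_apply', inner_smul_left, RCLike.conj_to_real, h1, h2,
      mlieBracket_smul_left hf hX, inner_add_left, inner_smul_right, map_smul]
    simp
    ring
  add {X X'} hX hX' := by
    have h1 := mvfderiv_fun_add (mdifferentiableAt_inner hX hZ) (mdifferentiableAt_inner hX' hZ)
    have h2 := mvfderiv_fun_add (mdifferentiableAt_inner hX hY) (mdifferentiableAt_inner hX' hY)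
    simp only [koszul, Pi.add_apply, inner_add_left, inner_add_right, h1, h2,
      mlieBracket_add_left hX hX', map_add]
    simp
    ring

theorem koszul_tensorial_right {Y : Π x : M, TangentSpace 𝓘(ℝ, E) x} {x : M}
    (hY : MDiffAt (T% Y) x) (X : Π x : M, TangentSpace 𝓘(ℝ, E) x) (hX : MDiffAt (T% X) x) :
    TensorialAt 𝓘(ℝ, E) E (fun Z ↦ koszul X Y Z x) x where
  smul {f Z} hf hZ := by
    have h1 := mvfderiv_fun_mul hf (mdifferentiableAt_inner hY hZ)
    have h2 := mvfderiv_fun_mul hf (mdifferentiableAt_inner hX hZ)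
    simp only [koszul, Pi.smul_apply', inner_smul_right, h1, h2,
      mlieBracket_smul_right hf hZ, inner_add_left, map_smul]
    simp [inner_smul_left]
    rw [real_inner_comm (X x) (Z x), real_inner_comm (Y x) (Z x)]
    ring
  add {Z Z'} hZ hZ' := by
    have h1 := mvfderiv_fun_add (mdifferentiableAt_inner hY hZ) (mdifferentiableAt_inner hY hZ')
    have h2 := mvfderiv_fun_add (mdifferentiableAt_inner hX hZ) (mdifferentiableAt_inner hX hZ')
    simp only [koszul, Pi.add_apply, inner_add_left, inner_add_right, h1, h2,
      mlieBracket_add_right hZ hZ', map_add]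
    simp
    ring

/-- The value at `x` of `∇ Y`, for a vector field `Y` differentiable at `x`: the linear map
`v ↦ ∇_v Y` with `⟪∇_v Y, w⟫` given by the Koszul formula. -/
def leviCivitaAux (Y : Π x : M, TangentSpace 𝓘(ℝ, E) x) (x : M) (hY : MDiffAt (T% Y) x) :
    TangentSpace 𝓘(ℝ, E) x →L[ℝ] TangentSpace 𝓘(ℝ, E) x :=
  LinearMap.toContinuousLinearMap
    { toFun := fun v ↦ (InnerProductSpace.toDual ℝ (TangentSpace 𝓘(ℝ, E) x)).symm
        (TensorialAt.mkHom₂ (fun X Z ↦ koszul X Y Z x) x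
          (koszul_tensorial_left hY) (koszul_tensorial_right hY) v)
      map_add' := fun v w ↦ by simp
      map_smul' := fun c v ↦ by simp }

theorem inner_leviCivitaAux {X Y Z : Π x : M, TangentSpace 𝓘(ℝ, E) x} {x : M}
    (hX : MDiffAt (T% X) x) (hY : MDiffAt (T% Y) x) (hZ : MDiffAt (T% Z) x) :
    inner ℝ (leviCivitaAux Y x hY (X x)) (Z x) = koszul X Y Z x := by
  simp only [leviCivitaAux, LinearMap.coe_toContinuousLinearMap', LinearMap.coe_mk,
    AddHom.coe_mk, InnerProductSpace.toDual_symm_apply]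
  exact TensorialAt.mkHom₂_apply (koszul_tensorial_left hY) (koszul_tensorial_right hY) hX hZ

theorem koszul_add {X Y Y' Z : Π x : M, TangentSpace 𝓘(ℝ, E) x} {x : M}
    (hX : MDiffAt (T% X) x) (hY : MDiffAt (T% Y) x) (hY' : MDiffAt (T% Y') x)
    (hZ : MDiffAt (T% Z) x) : koszul X (Y + Y') Z x = koszul X Y Z x + koszul X Y' Z x := by
  have h1 := mvfderiv_fun_add (mdifferentiableAt_inner hY hZ) (mdifferentiableAt_inner hY' hZ)
  have h2 := mvfderiv_fun_add (mdifferentiableAt_inner hX hY) (mdifferentiableAt_inner hX hY')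
  simp only [koszul, Pi.add_apply, inner_add_left, inner_add_right, h1, h2,
    mlieBracket_add_left hY hY', mlieBracket_add_right hY hY', map_add]
  simp
  ring

theorem koszul_smul {X Y Z : Π x : M, TangentSpace 𝓘(ℝ, E) x} {f : M → ℝ} {x : M}
    (hX : MDiffAt (T% X) x) (hY : MDiffAt (T% Y) x) (hZ : MDiffAt (T% Z) x) (hf : MDiffAt f x) :
    koszul X (f • Y) Z x =
      f x * koszul X Y Z x + mvfderiv 𝓘(ℝ, E) f x (X x) * inner ℝ (Y x) (Z x) := by
  have h1 := mvfderiv_fun_mul hf (mdifferentiableAt_inner hY hZ)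
  have h2 := mvfderiv_fun_mul hf (mdifferentiableAt_inner hX hY)
  simp only [koszul, Pi.smul_apply', inner_smul_left, inner_smul_right, RCLike.conj_to_real, h1,
    h2, mlieBracket_smul_left hf hY, mlieBracket_smul_right hf hY, inner_add_left, map_smul]
  simp
  rw [real_inner_comm (X x) (Y x)]
  ring

open Classical in
/-- The Levi-Civita connection of a Riemannian manifold; `leviCivita Y x v` is `∇_v Y` at `x`. -/
def leviCivita : CovariantDerivative 𝓘(ℝ, E) E (fun x : M ↦ TangentSpace 𝓘(ℝ, E) x) where
  toFun Y x := if hY : MDiffAt (T% Y) x then leviCivitaAux Y x hY else 0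
  isCovariantDerivativeOnUniv :=
    { add := fun {Y Y' x} hY hY' _ ↦ by
        have hs := mdifferentiableAt_add_section hY hY'
        rw [dif_pos hs, dif_pos hY, dif_pos hY']
        ext1 v
        refine ext_inner_right ℝ fun w ↦ ?_
        have hv := mdifferentiableAt_extend_tangent v
        have hw := mdifferentiableAt_extend_tangent w
        have h := koszul_add hv hY hY' hw
        rw [← inner_leviCivitaAux hv hY hw, ← inner_leviCivitaAux hv hY' hw,
          ← inner_leviCivitaAux hv hs hw] at h
        simpa [inner_add_left] using h
      leibniz := fun {Y f x} hY hf _ ↦ by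
        have hs := hf.smul_section hY
        rw [dif_pos hs, dif_pos hY]
        ext1 v
        refine ext_inner_right ℝ fun w ↦ ?_
        have hv := mdifferentiableAt_extend_tangent v
        have hw := mdifferentiableAt_extend_tangent w
        have h := koszul_smul hv hY hw hf
        rw [← inner_leviCivitaAux hv hY hw, ← inner_leviCivitaAux hv hs hw] at h
        simpa [inner_add_left, inner_smul_left] using h }

theorem inner_leviCivita {X Y Z : Π x : M, TangentSpace 𝓘(ℝ, E) x} {x : M}
    (hX : MDiffAt (T% X) x) (hY : MDiffAt (T% Y) x) (hZ : MDiffAt (T% Z) x) :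
    inner ℝ (leviCivita Y x (X x)) (Z x) = koszul X Y Z x := by
  simp only [leviCivita, dif_pos hY]
  exact inner_leviCivitaAux hX hY hZ

/-- The Levi-Civita connection is compatible with the metric. -/
theorem leviCivita_metric {X Y Z : Π x : M, TangentSpace 𝓘(ℝ, E) x} {x : M}
    (hX : MDiffAt (T% X) x) (hY : MDiffAt (T% Y) x) (hZ : MDiffAt (T% Z) x) :
    mvfderiv 𝓘(ℝ, E) (fun y ↦ inner ℝ (Y y) (Z y)) x (X x) =
      inner ℝ (leviCivita Y x (X x)) (Z x) + inner ℝ (Y x) (leviCivita Z x (X x)) := by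
  rw [real_inner_comm _ (Y x), inner_leviCivita hX hY hZ, inner_leviCivita hX hZ hY]
  simp only [koszul, fun y ↦ real_inner_comm (Y y) (Z y),
    mlieBracket_swap_apply (V := Z) (W := Y), inner_neg_left]
  ring

/-- The Levi-Civita connection is torsion-free. -/
theorem leviCivita_torsion {X Y : Π x : M, TangentSpace 𝓘(ℝ, E) x} {x : M}
    (hX : MDiffAt (T% X) x) (hY : MDiffAt (T% Y) x) :
    leviCivita Y x (X x) - leviCivita X x (Y x) = mlieBracket 𝓘(ℝ, E) X Y x := by
  refine ext_inner_right ℝ fun w ↦ ?_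
  have hw := mdifferentiableAt_extend_tangent w
  have h1 := inner_leviCivita hX hY hw
  have h2 := inner_leviCivita hY hX hw
  simp only [extend_apply_self] at h1 h2
  rw [inner_sub_left, h1, h2]
  have h3 : (fun y ↦ inner ℝ (X y) (Y y)) = fun y ↦ (inner ℝ (Y y) (X y) : ℝ) :=
    funext fun y ↦ real_inner_comm _ _
  simp only [koszul, h3, mlieBracket_swap_apply (V := Y) (W := X), inner_neg_left,
    extend_apply_self]
  ring

variable (E)

/-- The Riemannian gradient of a function. -/
def riemGrad (u : M → ℝ) (x : M) : TangentSpace 𝓘(ℝ, E) x :=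
  (InnerProductSpace.toDual ℝ (TangentSpace 𝓘(ℝ, E) x)).symm (mvfderiv 𝓘(ℝ, E) u x)

/-- The Riemannian divergence of a vector field, the trace of `v ↦ ∇_v X`. -/
def riemDiv (X : Π x : M, TangentSpace 𝓘(ℝ, E) x) (x : M) : ℝ :=
  LinearMap.trace ℝ (TangentSpace 𝓘(ℝ, E) x) (leviCivita X x).toLinearMap

/-- The vector field `(a(‖∇u‖) / ‖∇u‖) ∇u`; it is `0` at the critical points of `u`. -/
def fluxField (a : ℝ → ℝ) (u : M → ℝ) (x : M) : TangentSpace 𝓘(ℝ, E) x :=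
  (a ‖riemGrad E u x‖ / ‖riemGrad E u x‖) • riemGrad E u x

/-- `u` is a classical solution of the Dirichlet problem
`div ((a(‖∇u‖) / ‖∇u‖) ∇u) = 0` in `Ω`, `u = φ` on the boundary of `Ω`. -/
structure SolvesDirichlet (a : ℝ → ℝ) (Ω : Set M) (φ u : M → ℝ) : Prop where
  differentiable : ∀ x ∈ Ω, MDiffAt (T% (fluxField E a u)) x
  equation : ∀ x ∈ Ω, riemDiv E (fluxField E a u) x = 0
  boundary : ∀ x ∈ frontier Ω, u x = φ x

/-- `v` is a classical solution of the Dirichlet problem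
`div ((a(‖∇v‖) / ‖∇v‖) ∇v) - (a(‖∇v‖) / ‖∇v‖) ⟪∇v, J⟫ = 0` in `Λ`, `v = ψ` on the boundary
of `Λ`. -/
structure SolvesDirichletWithDrift (a : ℝ → ℝ) (J : Π x : M, TangentSpace 𝓘(ℝ, E) x)
    (Λ : Set M) (ψ v : M → ℝ) : Prop where
  differentiable : ∀ x ∈ Λ, MDiffAt (T% (fluxField E a v)) x
  equation : ∀ x ∈ Λ, riemDiv E (fluxField E a v) x
    - a ‖riemGrad E v x‖ / ‖riemGrad E v x‖ * inner ℝ (riemGrad E v x) (J x) = 0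
  boundary : ∀ x ∈ frontier Λ, v x = ψ x

end Riemannian

/-! ### Domains of class `C²` -/

/-- A domain (nonempty connected open set) of class `C²`: near each of its boundary points it is
the negativity set of a `C²` function whose differential does not vanish there. -/
structure IsC2Domain (E : Type*) [NormedAddCommGroup E] [NormedSpace ℝ E]
    {M : Type*} [TopologicalSpace M] [ChartedSpace E M] (Ω : Set M) : Prop where
  isOpen : IsOpen Ω
  isConnected : IsConnected Ω
  boundary : ∀ p ∈ frontier Ω, ∃ (U : Set M) (ρ : M → ℝ), IsOpen U ∧ p ∈ U ∧
    ContMDiffOn 𝓘(ℝ, E) 𝓘(ℝ, ℝ) 2 ρ U ∧ mvfderiv 𝓘(ℝ, E) ρ p ≠ 0 ∧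
    Ω ∩ U = {q ∈ U | ρ q < 0}

/-! ### Riemannian submersions, orbits and their mean curvature vector -/

section Submersion

variable {E : Type*} [NormedAddCommGroup E] [NormedSpace ℝ E] [FiniteDimensional ℝ E]
  {M : Type*} [TopologicalSpace M] [ChartedSpace E M]
  [RiemannianBundle (fun x : M ↦ TangentSpace 𝓘(ℝ, E) x)]
  {E' : Type*} [NormedAddCommGroup E'] [NormedSpace ℝ E']
  {N : Type*} [TopologicalSpace N] [ChartedSpace E' N]
  [RiemannianBundle (fun x : N ↦ TangentSpace 𝓘(ℝ, E') x)]

/-- A smooth submersion whose differential preserves the inner product of horizontal vectors,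
that is, of vectors orthogonal to the kernel of the differential. -/
structure IsRiemannianSubmersion (f : M → N) : Prop where
  isSubmersion : IsSubmersion 𝓘(ℝ, E) 𝓘(ℝ, E') ∞ f
  inner_map : ∀ p : M, ∀ v ∈ (mfderiv 𝓘(ℝ, E) 𝓘(ℝ, E') f p).kerᗮ,
    ∀ w ∈ (mfderiv 𝓘(ℝ, E) 𝓘(ℝ, E') f p).kerᗮ,
    inner ℝ (mfderiv 𝓘(ℝ, E) 𝓘(ℝ, E') f p v) (mfderiv 𝓘(ℝ, E) 𝓘(ℝ, E') f p w) = inner ℝ v w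

end Submersion

section Orbits

variable (E : Type*) [NormedAddCommGroup E] [NormedSpace ℝ E] [FiniteDimensional ℝ E]
  {M : Type*} [TopologicalSpace M] [ChartedSpace E M]
  (G : Type*) [Group G] [MulAction G M]

/-- The projection of `M` onto the orbit space `M / G`. -/
def orbitProj (p : M) : MulAction.orbitRel.Quotient G M := Quotient.mk'' p

/-- The tangent space at `p` of the orbit of `p`, spanned by the velocities at `p` of the
`C¹` curves that run in the orbit. -/
def orbitTangent (p : M) : Submodule ℝ (TangentSpace 𝓘(ℝ, E) p) :=
  Submodule.span ℝ {v | ∃ γ : ℝ → M, ContMDiffAt 𝓘(ℝ, ℝ) 𝓘(ℝ, E) 1 γ 0 ∧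
    (∀ᶠ t in 𝓝 (0 : ℝ), γ t ∈ MulAction.orbit G p) ∧
    (⟨p, v⟩ : TangentBundle 𝓘(ℝ, E) M) = ⟨γ 0, mfderiv 𝓘(ℝ, ℝ) 𝓘(ℝ, E) γ 0 (1 : ℝ)⟩}

variable [IsManifold 𝓘(ℝ, E) ∞ M] [RiemannianBundle (fun x : M ↦ TangentSpace 𝓘(ℝ, E) x)]
  [IsContMDiffRiemannianBundle 𝓘(ℝ, E) ∞ E (fun x : M ↦ TangentSpace 𝓘(ℝ, E) x)]

/-- The second fundamental form `II(v, w) = (∇_v W)^⊥` of the orbit through `p`, where `v` and `w`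
are tangent to the orbit and `W` is a vector field near `p` which is tangent to the orbits and
takes the value `w` at `p`: an extension of `w` to a vector field near `p`, projected
orthogonally onto the tangent spaces of the orbits. -/
def orbitSecondFundamentalForm (p : M) (v w : TangentSpace 𝓘(ℝ, E) p) :
    TangentSpace 𝓘(ℝ, E) p :=
  (orbitTangent E G p)ᗮ.starProjection
    (leviCivita (fun y ↦ (orbitTangent E G y).starProjection (extend E w y)) p v)

/-- The (non-normalized) mean curvature vector `∑ (∇_{E_i} E_i)^⊥` of the orbits, where `(E_i)` is
an orthonormal frame tangent to the orbits. -/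
def orbitMeanCurvature (p : M) : TangentSpace 𝓘(ℝ, E) p :=
  ∑ i, orbitSecondFundamentalForm E G p
    (stdOrthonormalBasis ℝ (orbitTangent E G p) i) (stdOrthonormalBasis ℝ (orbitTangent E G p) i)

end Orbits

end

noncomputable section

set_option linter.unusedSectionVars false

/-! ### Lie brackets as commutators of derivations on functions. -/

section LieDerivation

/-! Write f for the projection onto the orbit space, A for its differential and X̃ = A*X for the
horizontal lift of a field X on the base. Since f is a Riemannian submersion, A A* = 1, so A* is an
isometric embedding onto the horizontal space and A*A is the horizontal projection. As u = v ∘ f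
locally, ∇u is the lift of ∇v, the gradient norms agree, and the flux field of u is the lift of the
flux field of v.

Everything then rests on one formula (`riemDiv_horizontalLift`), valid for every X differentiable at
f(p): div X̃ = div X − ⟨X, A H⟩, where H is the mean curvature vector of the fibers. It comes from
splitting the trace of ∇X̃. The horizontal block is the trace of ∇X on the base: inner products and
Lie brackets of lifts project, so the Koszul expressions coincide. The vertical block is the sum of
⟨e, ∇_e X̃⟩ over an orthonormal basis of the kernel, and differentiating ⟨X̃, E⟩ = 0 along e, for a
vertical extension E of e, turns each summand into −⟨X, A(∇_e E)^⊥⟩.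

The same formula shows that H projects. It characterizes A H by the values of div X̃ − div X, and a
group element τ satisfies f ∘ τ = f and preserves the divergence, as one sees by applying the
formula to τ itself, whose kernel is zero. Hence A H is constant along orbits and defines J. Orbits
are the fibers of f and their tangent spaces are the kernels of A, so this H is the one in the
statement.

Solutions are classical, so differentiability must also pass both ways: X̃ is differentiable exactly
when X is, upward by testing against vector fields and downward by a local section of f. -/

theorem differentiableAt_fderiv_apply_field {E F : Type*} [NormedAddCommGroup E] [NormedSpace ℝ E]
    [NormedAddCommGroup F] [NormedSpace ℝ F] {h : E → F} {V : E → E} {x : E}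
    (hh : ContDiffAt ℝ 2 h x) (hV : DifferentiableAt ℝ V x) :
    DifferentiableAt ℝ (fun y ↦ fderiv ℝ h y (V y)) x :=
  ((hh.fderiv_right (m := 1) (by norm_num)).differentiableAt one_ne_zero).clm_apply hV

/-- By the product rule each iterated derivative contains a second derivative of `h`; these cancel
by symmetry, leaving the bracket. -/
theorem fderiv_lieBracket_apply {E F : Type*} [NormedAddCommGroup E] [NormedSpace ℝ E]
    [NormedAddCommGroup F] [NormedSpace ℝ F] {h : E → F} {V W : E → E} {x : E}
    (hh : ContDiffAt ℝ 2 h x) (hV : DifferentiableAt ℝ V x) (hW : DifferentiableAt ℝ W x) :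
    fderiv ℝ h x (lieBracket ℝ V W x) =
      fderiv ℝ (fun y ↦ fderiv ℝ h y (W y)) x (V x) -
        fderiv ℝ (fun y ↦ fderiv ℝ h y (V y)) x (W x) := by
  have hd : DifferentiableAt ℝ (fderiv ℝ h) x :=
    (hh.fderiv_right (m := 1) (by norm_num)).differentiableAt one_ne_zero
  have hs : IsSymmSndFDerivAt ℝ h x := hh.isSymmSndFDerivAt (by simp)
  rw [fderiv_clm_apply hd hW, fderiv_clm_apply hd hV]
  simp [lieBracket, hs.eq (V x) (W x)]

variable {E : Type*} [NormedAddCommGroup E] [NormedSpace ℝ E] [CompleteSpace E]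
  {M : Type*} [TopologicalSpace M] [ChartedSpace E M] [IsManifold 𝓘(ℝ, E) ∞ M]

/-- The vector field `V`, written in the preferred chart at `p`. -/
def chartField (V : Π x : M, TangentSpace 𝓘(ℝ, E) x) (p : M) (z : E) : E :=
  mpullbackWithin 𝓘(ℝ, E) 𝓘(ℝ, E) (extChartAt 𝓘(ℝ, E) p).symm V (range 𝓘(ℝ, E)) z

theorem contDiffAt_comp_extChartAt_symm {h : M → ℝ} {p : M} (hh : ContMDiffAt 𝓘(ℝ, E) 𝓘(ℝ, ℝ) 2 h p) :
    ContDiffAt ℝ 2 (h ∘ (extChartAt 𝓘(ℝ, E) p).symm) (extChartAt 𝓘(ℝ, E) p p) := by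
  rw [← contMDiffAt_iff_contDiffAt]
  have := contMDiffAt_iff_source.1 hh
  rwa [ModelWithCorners.range_eq_univ, contMDiffWithinAt_univ] at this

theorem mvfderiv_congr {h h' : M → ℝ} {p : M} (e : h =ᶠ[𝓝 p] h') :
    mvfderiv 𝓘(ℝ, E) h p = mvfderiv 𝓘(ℝ, E) h' p :=
  e.mfderiv_eq (I := 𝓘(ℝ, E)) (I' := 𝓘(ℝ, ℝ))

/-- Needed on a whole neighborhood, not only at `p`, because the derivative of `h` along `V` is
itself differentiated afterwards. -/
theorem eventually_mvfderiv_extChartAt_symm {h : M → ℝ} {p : M}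
    (hh : ContMDiffAt 𝓘(ℝ, E) 𝓘(ℝ, ℝ) 2 h p) (V : Π x : M, TangentSpace 𝓘(ℝ, E) x) :
    ∀ᶠ z in 𝓝 (extChartAt 𝓘(ℝ, E) p p),
      mvfderiv 𝓘(ℝ, E) h ((extChartAt 𝓘(ℝ, E) p).symm z) (V ((extChartAt 𝓘(ℝ, E) p).symm z)) =
        fderiv ℝ (h ∘ (extChartAt 𝓘(ℝ, E) p).symm) z
          (chartField V p z) := by
  have h2 : ∀ᶠ z in 𝓝 (extChartAt 𝓘(ℝ, E) p p),
      MDifferentiableAt 𝓘(ℝ, E) 𝓘(ℝ, ℝ) h ((extChartAt 𝓘(ℝ, E) p).symm z) := by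
    have hc := continuousAt_extChartAt_symm (I := 𝓘(ℝ, E)) p
    rw [ContinuousAt, extChartAt_to_inv] at hc
    exact hc.eventually (((contMDiffAt_iff_contMDiffAt_nhds (by simp)).1 hh).mono
      fun y hy ↦ hy.mdifferentiableAt two_ne_zero)
  filter_upwards [extChartAt_target_mem_nhds (I := 𝓘(ℝ, E)) p, h2] with z hz hz2
  have hd := mdifferentiableWithinAt_extChartAt_symm hz
  have hi := isInvertible_mfderivWithin_extChartAt_symm hz
  rw [chartField, mpullbackWithin_apply]
  rw [ModelWithCorners.range_eq_univ, mdifferentiableWithinAt_univ] at hd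
  rw [ModelWithCorners.range_eq_univ, mfderivWithin_univ] at hi ⊢
  have := mvfderiv_comp_apply z hz2 hd
    ((mfderiv 𝓘(ℝ, E) 𝓘(ℝ, E) (extChartAt 𝓘(ℝ, E) p).symm z).inverse
      (V ((extChartAt 𝓘(ℝ, E) p).symm z)))
  rw [hi.self_apply_inverse] at this
  rw [← this]
  unfold mvfderiv
  rw [mfderiv_eq_fderiv]
  rfl

theorem chartField_self (V : Π x : M, TangentSpace 𝓘(ℝ, E) x) (p : M) :
    chartField V p (extChartAt 𝓘(ℝ, E) p p) = (V p : E) :=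
  (mfderivWithin_extChartAt_symm_inverse_apply (I := 𝓘(ℝ, E)) (x := p) _).trans
    (congrArg (fun y ↦ (V y : E)) (extChartAt_to_inv (I := 𝓘(ℝ, E)) p))

theorem differentiableAt_chartField {V : Π x : M, TangentSpace 𝓘(ℝ, E) x}
    {p : M} (hV : MDiffAt (T% V) p) :
    DifferentiableAt ℝ (chartField V p) (extChartAt 𝓘(ℝ, E) p p) := by
  have h0 : ∀ s : Set E, s = univ →
      DifferentiableWithinAt ℝ (chartField V p) s (extChartAt 𝓘(ℝ, E) p p) →
      DifferentiableAt ℝ (chartField V p) (extChartAt 𝓘(ℝ, E) p p) := by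
    rintro s rfl h
    exact differentiableWithinAt_univ.1 h
  exact h0 _ (by simp) (MDifferentiableWithinAt.differentiableWithinAt_mpullbackWithin_vectorField
    (s := univ) (mdifferentiableWithinAt_univ.2 hV))

theorem mvfderiv_eq_fderiv_comp_extChartAt_symm {h : M → ℝ} {p : M}
    (hh : MDifferentiableAt 𝓘(ℝ, E) 𝓘(ℝ, ℝ) h p) (v : E) :
    mvfderiv 𝓘(ℝ, E) h p v =
      fderiv ℝ (h ∘ (extChartAt 𝓘(ℝ, E) p).symm) (extChartAt 𝓘(ℝ, E) p p) v := by
  rw [hh.mvfderiv, ModelWithCorners.range_eq_univ, fderivWithin_univ]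
  rfl

theorem eventually_comp_extChartAt_symm {h : M → ℝ} {p : M} {k : E → ℝ}
    (hk : ∀ᶠ z in 𝓝 (extChartAt 𝓘(ℝ, E) p p), h ((extChartAt 𝓘(ℝ, E) p).symm z) = k z) :
    h =ᶠ[𝓝 p] k ∘ extChartAt 𝓘(ℝ, E) p := by
  filter_upwards [(continuousAt_extChartAt (I := 𝓘(ℝ, E)) p).eventually hk,
    extChartAt_source_mem_nhds (I := 𝓘(ℝ, E)) p] with y hy hy'
  rw [Function.comp_apply, ← hy, (extChartAt 𝓘(ℝ, E) p).left_inv hy']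

theorem mdifferentiableAt_mvfderiv_apply {h : M → ℝ} {V : Π x : M, TangentSpace 𝓘(ℝ, E) x} {p : M}
    (hh : ContMDiffAt 𝓘(ℝ, E) 𝓘(ℝ, ℝ) 2 h p) (hV : MDiffAt (T% V) p) :
    MDiffAt (fun y ↦ mvfderiv 𝓘(ℝ, E) h y (V y)) p := by
  have hd := differentiableAt_fderiv_apply_field (contDiffAt_comp_extChartAt_symm hh)
    (differentiableAt_chartField hV)
  exact (hd.mdifferentiableAt.comp p (mdifferentiableAt_extChartAt (mem_chart_source E p)))
    |>.congr_of_eventuallyEq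
      (eventually_comp_extChartAt_symm (eventually_mvfderiv_extChartAt_symm hh V))

/-- The Lie bracket acts on functions as the commutator of the derivations. -/
theorem mvfderiv_mlieBracket {h : M → ℝ} {V W : Π x : M, TangentSpace 𝓘(ℝ, E) x} {p : M}
    (hh : ContMDiffAt 𝓘(ℝ, E) 𝓘(ℝ, ℝ) 2 h p) (hV : MDiffAt (T% V) p) (hW : MDiffAt (T% W) p) :
    mvfderiv 𝓘(ℝ, E) h p (mlieBracket 𝓘(ℝ, E) V W p) =
      mvfderiv 𝓘(ℝ, E) (fun y ↦ mvfderiv 𝓘(ℝ, E) h y (W y)) p (V p) -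
        mvfderiv 𝓘(ℝ, E) (fun y ↦ mvfderiv 𝓘(ℝ, E) h y (V y)) p (W p) := by
  have hl := fderiv_lieBracket_apply (contDiffAt_comp_extChartAt_symm hh)
    (differentiableAt_chartField hV)
    (differentiableAt_chartField hW)
  have hb : mlieBracket 𝓘(ℝ, E) V W p =
      lieBracket ℝ (chartField V p) (chartField W p) (extChartAt 𝓘(ℝ, E) p p) := by
    -- The manifold bracket is pulled back through the chart at `p`, whose derivative at its own
    -- center is the identity.
    have hi : (mfderiv 𝓘(ℝ, E) 𝓘(ℝ, E) (extChartAt 𝓘(ℝ, E) p) p).inverse =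
        ContinuousLinearMap.id ℝ E := by
      rw [mfderiv_extChartAt_self]
      exact ContinuousLinearMap.inverse_id
    have h0 : ∀ s : Set E, s = univ →
        lieBracketWithin ℝ (chartField V p) (chartField W p) s (extChartAt 𝓘(ℝ, E) p p) =
        lieBracket ℝ (chartField V p) (chartField W p) (extChartAt 𝓘(ℝ, E) p p) := by
      rintro s rfl
      rw [lieBracketWithin_univ]
    exact (DFunLike.congr_fun hi _).trans (h0 _ (by simp))
  have hd : ∀ (U : Π x : M, TangentSpace 𝓘(ℝ, E) x), MDiffAt (T% U) p → ∀ v : E,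
      mvfderiv 𝓘(ℝ, E) (fun y ↦ mvfderiv 𝓘(ℝ, E) h y (U y)) p v =
      fderiv ℝ (fun z ↦ fderiv ℝ (h ∘ (extChartAt 𝓘(ℝ, E) p).symm) z
        (chartField U p z))
        (extChartAt 𝓘(ℝ, E) p p) v := by
    intro U hU v
    rw [mvfderiv_eq_fderiv_comp_extChartAt_symm (mdifferentiableAt_mvfderiv_apply hh hU)]
    exact DFunLike.congr_fun
      (Filter.EventuallyEq.fderiv_eq (eventually_mvfderiv_extChartAt_symm hh U)) v
  have he : ∀ (U X : Π x : M, TangentSpace 𝓘(ℝ, E) x), MDiffAt (T% U) p →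
      fderiv ℝ (fun z ↦ fderiv ℝ (h ∘ (extChartAt 𝓘(ℝ, E) p).symm) z (chartField U p z))
        (extChartAt 𝓘(ℝ, E) p p) (chartField X p (extChartAt 𝓘(ℝ, E) p p)) =
      mvfderiv 𝓘(ℝ, E) (fun y ↦ mvfderiv 𝓘(ℝ, E) h y (U y)) p (X p) :=
    fun U X hU ↦ (congrArg _ (chartField_self X p)).trans (hd U hU _).symm
  rw [he W V hW, he V W hV] at hl
  exact (congrArg _ hb).trans
    ((mvfderiv_eq_fderiv_comp_extChartAt_symm (hh.mdifferentiableAt two_ne_zero) _).trans hl)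

end LieDerivation

/-! ### Naturality of the Lie bracket. -/

section Related

variable {E : Type*} [NormedAddCommGroup E] [NormedSpace ℝ E] [CompleteSpace E]
  {M : Type*} [TopologicalSpace M] [ChartedSpace E M] [IsManifold 𝓘(ℝ, E) ∞ M]
  {E' : Type*} [NormedAddCommGroup E'] [NormedSpace ℝ E'] [CompleteSpace E']
  {N : Type*} [TopologicalSpace N] [ChartedSpace E' N] [IsManifold 𝓘(ℝ, E') ∞ N]

/-- Related vector fields have related Lie brackets. -/
theorem mfderiv_mlieBracket_of_related {f : M → N} {p : M}
    (hf : ContMDiffAt 𝓘(ℝ, E) 𝓘(ℝ, E') 2 f p)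
    {V W : Π x : M, TangentSpace 𝓘(ℝ, E) x} {X Y : Π x : N, TangentSpace 𝓘(ℝ, E') x}
    (hV : MDiffAt (T% V) p) (hW : MDiffAt (T% W) p)
    (hX : MDiffAt (T% X) (f p)) (hY : MDiffAt (T% Y) (f p))
    (hVX : ∀ᶠ y in 𝓝 p, mfderiv 𝓘(ℝ, E) 𝓘(ℝ, E') f y (V y) = X (f y))
    (hWY : ∀ᶠ y in 𝓝 p, mfderiv 𝓘(ℝ, E) 𝓘(ℝ, E') f y (W y) = Y (f y)) :
    mfderiv 𝓘(ℝ, E) 𝓘(ℝ, E') f p (mlieBracket 𝓘(ℝ, E) V W p) =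
      mlieBracket 𝓘(ℝ, E') X Y (f p) := by
  -- Two tangent vectors are compared through their action on `C²` functions, where both brackets
  -- become commutators.
  have key : ∀ (h : N → ℝ), ContMDiffAt 𝓘(ℝ, E') 𝓘(ℝ, ℝ) 2 h (f p) →
      mvfderiv 𝓘(ℝ, E') h (f p) (mfderiv 𝓘(ℝ, E) 𝓘(ℝ, E') f p (mlieBracket 𝓘(ℝ, E) V W p)) =
      mvfderiv 𝓘(ℝ, E') h (f p) (mlieBracket 𝓘(ℝ, E') X Y (f p)) := by
    intro h hh
    have hhf : ContMDiffAt 𝓘(ℝ, E) 𝓘(ℝ, ℝ) 2 (h ∘ f) p := hh.comp p hf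
    have hfe : ∀ᶠ y in 𝓝 p, MDifferentiableAt 𝓘(ℝ, E) 𝓘(ℝ, E') f y :=
      ((contMDiffAt_iff_contMDiffAt_nhds (by simp)).1 hf).mono fun y hy ↦ hy.mdifferentiableAt two_ne_zero
    have hhe : ∀ᶠ y in 𝓝 p, MDifferentiableAt 𝓘(ℝ, E') 𝓘(ℝ, ℝ) h (f y) :=
      hf.continuousAt.eventually
        (((contMDiffAt_iff_contMDiffAt_nhds (by simp)).1 hh).mono fun y hy ↦ hy.mdifferentiableAt two_ne_zero)
    have e : ∀ {V : Π x : M, TangentSpace 𝓘(ℝ, E) x} {X : Π x : N, TangentSpace 𝓘(ℝ, E') x},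
        (∀ᶠ y in 𝓝 p, mfderiv 𝓘(ℝ, E) 𝓘(ℝ, E') f y (V y) = X (f y)) →
        (fun y ↦ mvfderiv 𝓘(ℝ, E) (h ∘ f) y (V y)) =ᶠ[𝓝 p]
          (fun z ↦ mvfderiv 𝓘(ℝ, E') h z (X z)) ∘ f := by
      intro V X hVX
      filter_upwards [hVX, hfe, hhe] with y hy h1 h2
      rw [Function.comp_apply, ← hy, mvfderiv_comp_apply y h2 h1]
    have d : ∀ {X : Π x : N, TangentSpace 𝓘(ℝ, E') x} {V W : Π x : M, TangentSpace 𝓘(ℝ, E) x},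
        MDiffAt (T% X) (f p) →
        (∀ᶠ y in 𝓝 p, mfderiv 𝓘(ℝ, E) 𝓘(ℝ, E') f y (V y) = X (f y)) →
        mvfderiv 𝓘(ℝ, E) (fun y ↦ mvfderiv 𝓘(ℝ, E) (h ∘ f) y (V y)) p (W p) =
        mvfderiv 𝓘(ℝ, E') (fun z ↦ mvfderiv 𝓘(ℝ, E') h z (X z)) (f p)
          (mfderiv 𝓘(ℝ, E) 𝓘(ℝ, E') f p (W p)) := by
      intro X V W hX hVX
      rw [← mvfderiv_comp_apply p (mdifferentiableAt_mvfderiv_apply hh hX)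
        (hf.mdifferentiableAt two_ne_zero), mvfderiv_congr (e hVX)]
    rw [← mvfderiv_comp_apply p (hh.mdifferentiableAt two_ne_zero)
      (hf.mdifferentiableAt two_ne_zero), mvfderiv_mlieBracket hhf hV hW,
      mvfderiv_mlieBracket hh hX hY, d hX hVX, d hY hWY, hVX.self_of_nhds, hWY.self_of_nhds]
  -- Continuous linear functionals of the chart are enough test functions: their derivatives at the
  -- center are all of the dual space.
  have hL : ∀ (L : E' →L[ℝ] ℝ) (w : E'),
      mvfderiv 𝓘(ℝ, E') (L ∘ extChartAt 𝓘(ℝ, E') (f p)) (f p) w = L w := by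
    intro L w
    have h1 : MDifferentiableAt 𝓘(ℝ, E') 𝓘(ℝ, ℝ) L (extChartAt 𝓘(ℝ, E') (f p) (f p)) :=
      L.differentiableAt.mdifferentiableAt
    have h2 := mvfderiv_comp_apply (f p) h1
      (mdifferentiableAt_extChartAt (I := 𝓘(ℝ, E')) (mem_chart_source E' (f p))) w
    rw [mfderiv_extChartAt_self] at h2
    rw [h2]
    unfold mvfderiv
    rw [mfderiv_eq_fderiv, L.fderiv]
    rfl
  refine (SeparatingDual.eq_iff_forall_dual_eq (R := ℝ) (V := E')).2 fun L ↦ ?_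
  exact ((hL L _).symm.trans (key _ ((L.contDiff.contMDiff.contMDiffAt).comp (f p)
    contMDiffAt_extChartAt))).trans (hL L _)

end Related

/-! ### Linear algebra of a surjection that is isometric on the orthogonal of its kernel. -/

section Coisometry

open ContinuousLinearMap

variable {V W : Type*} [NormedAddCommGroup V] [InnerProductSpace ℝ V] [CompleteSpace V]
  [NormedAddCommGroup W] [InnerProductSpace ℝ W] [CompleteSpace W] {A : V →L[ℝ] W}

/-- On the orthogonal of the kernel, `adjoint A` inverts `A`, since `A` preserves inner products
there; and every `w` is the image of such a vector. -/
theorem apply_adjoint_of_surjective_of_inner_map (hs : Function.Surjective A)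
    (hi : ∀ v ∈ A.kerᗮ, ∀ w ∈ A.kerᗮ, inner ℝ (A v) (A w) = inner ℝ v w) (w : W) :
    A (adjoint A w) = w := by
  have : CompleteSpace A.ker := (ContinuousLinearMap.isClosed_ker A).completeSpace_coe
  have hdec : ∀ v : V, ∃ v' ∈ A.kerᗮ, ∃ k ∈ A.ker, v = v' + k := fun v ↦
    ⟨v - A.ker.starProjection v, A.ker.sub_starProjection_mem_orthogonal v,
      A.ker.starProjection v, A.ker.starProjection_apply_mem v, by simp⟩
  have hker : ∀ k ∈ A.ker, A k = 0 := fun k hk ↦ hk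
  have h1 : ∀ v ∈ A.kerᗮ, adjoint A (A v) = v := by
    refine fun v hv ↦ ext_inner_right ℝ fun z ↦ ?_
    obtain ⟨z', hz', k, hk, rfl⟩ := hdec z
    rw [adjoint_inner_left, map_add, hker k hk, add_zero, hi v hv z' hz', inner_add_right,
      Submodule.inner_left_of_mem_orthogonal hk hv, add_zero]
  obtain ⟨v, rfl⟩ := hs w
  obtain ⟨v', hv', k, hk, rfl⟩ := hdec v
  rw [map_add, hker k hk, add_zero, h1 v' hv']

variable (hA : ∀ w, A (adjoint A w) = w)
include hA

theorem inner_adjoint_adjoint (x y : W) : inner ℝ (adjoint A x) (adjoint A y) = inner ℝ x y := by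
  rw [adjoint_inner_left, hA]

theorem norm_adjoint_apply (x : W) : ‖adjoint A x‖ = ‖x‖ := by
  rw [norm_eq_sqrt_real_inner, inner_adjoint_adjoint hA, ← norm_eq_sqrt_real_inner]

/-- The horizontal projection is A*A. This formula is what makes the vertical projection depend
differentiably on the point. -/
theorem starProjection_ker_apply [A.ker.HasOrthogonalProjection] (v : V) :
    A.ker.starProjection v = v - adjoint A (A v) := by
  refine Submodule.eq_starProjection_of_mem_orthogonal ?_ ?_
  · change A (v - adjoint A (A v)) = 0
    rw [map_sub, hA, sub_self]
  · rw [sub_sub_cancel, Submodule.mem_orthogonal]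
    intro k hk
    rw [adjoint_inner_right, show A k = 0 from hk, inner_zero_left]

theorem apply_starProjection_orthogonal_ker [A.ker.HasOrthogonalProjection] (v : V) :
    A (A.kerᗮ.starProjection v) = A v := by
  rw [Submodule.starProjection_orthogonal_val, map_sub,
    show A (A.ker.starProjection v) = 0 from A.ker.starProjection_apply_mem v, sub_zero]

end Coisometry

/-! ### Splitting a trace into vertical and horizontal blocks. -/

section Trace

open ContinuousLinearMap

variable {V W : Type*} [NormedAddCommGroup V] [InnerProductSpace ℝ V] [FiniteDimensional ℝ V]
  [NormedAddCommGroup W] [InnerProductSpace ℝ W] [FiniteDimensional ℝ W]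

/-- Write T = P T + A*A T with P the projection onto the kernel, and use the cyclicity of the trace
on each summand. -/
theorem trace_eq_sum_ker_add_trace [CompleteSpace V] [CompleteSpace W] {A : V →L[ℝ] W}
    (hA : ∀ w, A (adjoint A w) = w) (T : V →L[ℝ] V) :
    LinearMap.trace ℝ V T.toLinearMap =
      (∑ i, inner ℝ (stdOrthonormalBasis ℝ A.ker i : V) (T (stdOrthonormalBasis ℝ A.ker i))) +
        LinearMap.trace ℝ W (A ∘L T ∘L adjoint A).toLinearMap := by
  have h1 : T.toLinearMap = A.ker.subtype ∘ₗ (A.ker.orthogonalProjectionOnto.toLinearMap ∘ₗ T.toLinearMap)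
      + (adjoint A).toLinearMap ∘ₗ (A.toLinearMap ∘ₗ T.toLinearMap) := by
    ext v
    have := starProjection_ker_apply hA (T v)
    rw [Submodule.starProjection_apply] at this
    simp [this]
  have h2 : LinearMap.trace ℝ A.ker
      ((A.ker.orthogonalProjectionOnto.toLinearMap ∘ₗ T.toLinearMap) ∘ₗ A.ker.subtype) =
      ∑ i, inner ℝ (stdOrthonormalBasis ℝ A.ker i : V) (T (stdOrthonormalBasis ℝ A.ker i)) := by
    rw [LinearMap.trace_eq_sum_inner _ (stdOrthonormalBasis ℝ A.ker)]
    refine Finset.sum_congr rfl fun i _ ↦ ?_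
    simp
  conv_lhs => rw [h1]
  rw [map_add, LinearMap.trace_comp_comm', LinearMap.trace_comp_comm' (A.toLinearMap ∘ₗ T.toLinearMap), h2]
  rfl

end Trace

/-! ### Differentiability of a vector field tested by inner products. -/

section Musical

variable {E : Type*} [NormedAddCommGroup E] [NormedSpace ℝ E] [FiniteDimensional ℝ E]
  {M : Type*} [TopologicalSpace M] [ChartedSpace E M] [IsManifold 𝓘(ℝ, E) ∞ M]

theorem mdifferentiableAt_det {ι : Type} [Fintype ι] [DecidableEq ι] {Γ : M → Matrix ι ι ℝ} {p : M}
    (hΓ : ∀ i j, MDiffAt (fun y ↦ Γ y i j) p) : MDiffAt (fun y ↦ (Γ y).det) p := by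
  let F : Equiv.Perm ι → M → ℝ := fun σ ↦
    (fun _ ↦ ((Equiv.Perm.sign σ : ℤ) : ℝ)) * ∏ i, fun y ↦ Γ y (σ i) i
  have hF : ∀ σ ∈ (Finset.univ : Finset (Equiv.Perm ι)), MDiffAt (F σ) p := fun σ _ ↦
    MDifferentiableAt.mul mdifferentiableAt_const (MDifferentiableAt.prod fun i _ ↦ hΓ (σ i) i)
  have h := MDifferentiableAt.sum hF
  have he : ∑ σ, F σ = fun y ↦ (Γ y).det := by
    ext y
    simp [F, Matrix.det_apply']
  rwa [he] at h

variable [RiemannianBundle (fun x : M ↦ TangentSpace 𝓘(ℝ, E) x)]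
  [IsContMDiffRiemannianBundle 𝓘(ℝ, E) ∞ E (fun x : M ↦ TangentSpace 𝓘(ℝ, E) x)]

/-- A vector field whose inner products with differentiable vector fields are differentiable is
differentiable. -/
theorem mdifferentiableAt_of_inner {s : Π x : M, TangentSpace 𝓘(ℝ, E) x} {p : M}
    (h : ∀ Z : Π x : M, TangentSpace 𝓘(ℝ, E) x, MDiffAt (T% Z) p →
      MDiffAt (fun y ↦ (inner ℝ (s y) (Z y) : ℝ)) p) : MDiffAt (T% s) p := by
  classical
  set e := trivializationAt E (TangentSpace 𝓘(ℝ, E) : M → Type _) p with he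
  have hp : p ∈ e.baseSet := mem_baseSet_trivializationAt' p
  have hu : e.baseSet ∈ 𝓝 p := e.open_baseSet.mem_nhds hp
  have hs := e.isLocalFrameOn_localFrame_baseSet 𝓘(ℝ, E) 1 (Module.finBasis ℝ E)
  set fr := e.localFrame (Module.finBasis ℝ E) with hfr
  have hd : ∀ i, MDiffAt (T% (fr i)) p := fun i ↦
    (hs.contMDiffAt e.open_baseSet hp i).mdifferentiableAt one_ne_zero
  refine hs.mdifferentiableAt_of_coeff (fun i ↦ ?_) hu
  have hΓ : ∀ i j, MDiffAt (fun y ↦ Matrix.gram ℝ (fun k ↦ fr k y) i j) p :=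
    fun i j ↦ mdifferentiableAt_inner (hd i) (hd j)
  have hβ : ∀ i, MDiffAt (fun y ↦ (inner ℝ (fr i y) (s y) : ℝ)) p := by
    intro i
    simp_rw [fun y ↦ real_inner_comm (s y) (fr i y)]
    exact h _ (hd i)
  have hdet : ∀ y ∈ e.baseSet, (Matrix.gram ℝ (fun k ↦ fr k y)).det ≠ 0 := fun y hy ↦
    Matrix.det_gram_ne_zero_iff_linearIndependent.2 (hs.linearIndependent hy)
  -- In a local frame the coefficients of `s` solve the linear system given by the Gram matrix;
  -- Cramer's rule writes them as quotients of determinants with differentiable entries.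
  have key : ∀ y ∈ e.baseSet, hs.coeff i y (s y) =
      ((Matrix.gram ℝ (fun k ↦ fr k y)).updateCol i (fun k ↦ inner ℝ (fr k y) (s y))).det /
        (Matrix.gram ℝ (fun k ↦ fr k y)).det := by
    intro y hy
    have h0 : (Matrix.gram ℝ (fun k ↦ fr k y)).mulVec (fun j ↦ hs.coeff j y (s y)) =
        fun k ↦ inner ℝ (fr k y) (s y) := by
      ext k
      conv_rhs => rw [hs.coeff_sum_eq s hy]
      simp only [Matrix.mulVec, dotProduct, Matrix.gram_apply, inner_sum, inner_smul_right]
      exact Finset.sum_congr rfl fun j _ ↦ mul_comm _ _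
    rw [← Matrix.cramer_apply, ← h0, Matrix.cramer_eq_adjugate_mulVec, Matrix.mulVec_mulVec,
      Matrix.adjugate_mul, Matrix.smul_mulVec, Matrix.one_mulVec, Pi.smul_apply, smul_eq_mul,
      mul_div_cancel_left₀ _ (hdet y hy)]
  refine MDifferentiableAt.congr_of_eventuallyEq ?_ (Filter.eventually_of_mem hu key)
  refine MDifferentiableAt.div (mdifferentiableAt_det fun k l ↦ ?_) (mdifferentiableAt_det hΓ)
    (hdet p hp)
  by_cases hl : l = i
  · subst hl
    simpa using hβ k
  · simpa [Matrix.updateCol_ne hl] using hΓ k l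

end Musical

/-! ### Horizontal lifts and their covariant derivatives. -/

section HorizontalLift

variable {E : Type*} [NormedAddCommGroup E] [NormedSpace ℝ E] [FiniteDimensional ℝ E]
  {M : Type*} [TopologicalSpace M] [ChartedSpace E M] [IsManifold 𝓘(ℝ, E) ∞ M]
  [RiemannianBundle (fun x : M ↦ TangentSpace 𝓘(ℝ, E) x)]
  {E' : Type*} [NormedAddCommGroup E'] [NormedSpace ℝ E'] [FiniteDimensional ℝ E']
  {N : Type*} [TopologicalSpace N] [ChartedSpace E' N] [IsManifold 𝓘(ℝ, E') ∞ N]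
  [RiemannianBundle (fun x : N ↦ TangentSpace 𝓘(ℝ, E') x)]

variable (E E') in
/-- The adjoint of the differential of `f` at `p`. -/
def adjointDeriv (f : M → N) (p : M) :
    TangentSpace 𝓘(ℝ, E') (f p) →L[ℝ] TangentSpace 𝓘(ℝ, E) p :=
  ContinuousLinearMap.adjoint (mfderiv 𝓘(ℝ, E) 𝓘(ℝ, E') f p)

variable (E E') in
/-- The vector field on `M` obtained by applying the adjoint of the differential of `f` to a vector
field on `N`; it is the horizontal lift if `f` is a Riemannian submersion. -/
def horizontalLift (f : M → N) (X : Π x : N, TangentSpace 𝓘(ℝ, E') x) (p : M) :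
    TangentSpace 𝓘(ℝ, E) p :=
  adjointDeriv E E' f p (X (f p))

theorem adjointDeriv_inner_left (f : M → N) (p : M) (w : TangentSpace 𝓘(ℝ, E') (f p))
    (v : TangentSpace 𝓘(ℝ, E) p) :
    inner ℝ (adjointDeriv E E' f p w) v = inner ℝ w (mfderiv 𝓘(ℝ, E) 𝓘(ℝ, E') f p v) :=
  ContinuousLinearMap.adjoint_inner_left _ _ _

theorem mdifferentiableAt_mfderiv_apply {f : M → N} (hf : ContMDiff 𝓘(ℝ, E) 𝓘(ℝ, E') ∞ f)
    {Z : Π x : M, TangentSpace 𝓘(ℝ, E) x} {p : M} (hZ : MDiffAt (T% Z) p) :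
    MDifferentiableAt 𝓘(ℝ, E) (𝓘(ℝ, E').prod 𝓘(ℝ, E'))
      (fun y ↦ (⟨f y, mfderiv 𝓘(ℝ, E) 𝓘(ℝ, E') f y (Z y)⟩ : TangentBundle 𝓘(ℝ, E') N)) p := by
  have h : ContMDiff (𝓘(ℝ, E).prod 𝓘(ℝ, E)) (𝓘(ℝ, E').prod 𝓘(ℝ, E')) 1
      (tangentMap 𝓘(ℝ, E) 𝓘(ℝ, E') f) := hf.contMDiff_tangentMap (by norm_cast)
  exact (h.mdifferentiable one_ne_zero _).comp p hZ

variable [IsContMDiffRiemannianBundle 𝓘(ℝ, E) ∞ E (fun x : M ↦ TangentSpace 𝓘(ℝ, E) x)]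
  [IsContMDiffRiemannianBundle 𝓘(ℝ, E') ∞ E' (fun x : N ↦ TangentSpace 𝓘(ℝ, E') x)]

/-- Against a test field `Z` the adjoint moves over to the differential of `f` applied to `Z`, which
is differentiable along `f`. -/
theorem mdifferentiableAt_adjointDeriv {f : M → N} (hf : ContMDiff 𝓘(ℝ, E) 𝓘(ℝ, E') ∞ f)
    {Y : Π y : M, TangentSpace 𝓘(ℝ, E') (f y)} {p : M}
    (hY : MDifferentiableAt 𝓘(ℝ, E) (𝓘(ℝ, E').prod 𝓘(ℝ, E'))
      (fun y ↦ (⟨f y, Y y⟩ : TangentBundle 𝓘(ℝ, E') N)) p) :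
    MDiffAt (T% (fun y ↦ adjointDeriv E E' f y (Y y))) p := by
  refine mdifferentiableAt_of_inner fun Z hZ ↦ ?_
  simp_rw [adjointDeriv_inner_left]
  exact MDifferentiableAt.inner_bundle (IB := 𝓘(ℝ, E')) (F := E')
    (E := fun x : N ↦ TangentSpace 𝓘(ℝ, E') x) (b := f) hY (mdifferentiableAt_mfderiv_apply hf hZ)

theorem mdifferentiableAt_horizontalLift {f : M → N} (hf : ContMDiff 𝓘(ℝ, E) 𝓘(ℝ, E') ∞ f)
    {X : Π x : N, TangentSpace 𝓘(ℝ, E') x} {p : M} (hX : MDiffAt (T% X) (f p)) :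
    MDiffAt (T% (horizontalLift E E' f X)) p :=
  mdifferentiableAt_adjointDeriv hf
    (hX.comp p (hf.contMDiffAt.mdifferentiableAt (by simp)))

variable {f : M → N} (hf : ContMDiff 𝓘(ℝ, E) 𝓘(ℝ, E') ∞ f)
  (hA : ∀ (p : M) (w : TangentSpace 𝓘(ℝ, E') (f p)),
    mfderiv 𝓘(ℝ, E) 𝓘(ℝ, E') f p (adjointDeriv E E' f p w) = w)
include hf hA

/-- A lift is `f`-related to the field it lifts, so the brackets are related; pairing with a third
lift sees only the projected bracket. -/
theorem inner_mlieBracket_horizontalLift {X Y : Π x : N, TangentSpace 𝓘(ℝ, E') x} {p : M}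
    (hX : MDiffAt (T% X) (f p)) (hY : MDiffAt (T% Y) (f p)) (Z : Π x : N, TangentSpace 𝓘(ℝ, E') x) :
    inner ℝ (mlieBracket 𝓘(ℝ, E) (horizontalLift E E' f X) (horizontalLift E E' f Y) p)
      (horizontalLift E E' f Z p) = inner ℝ (mlieBracket 𝓘(ℝ, E') X Y (f p)) (Z (f p)) := by
  rw [real_inner_comm, horizontalLift, adjointDeriv_inner_left,
    mfderiv_mlieBracket_of_related (hf.contMDiffAt.of_le (by norm_cast))
      (mdifferentiableAt_horizontalLift hf hX)
      (mdifferentiableAt_horizontalLift hf hY) hX hY (Eventually.of_forall fun y ↦ hA y _)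
      (Eventually.of_forall fun y ↦ hA y _), real_inner_comm]

theorem mvfderiv_inner_horizontalLift {X Y : Π x : N, TangentSpace 𝓘(ℝ, E') x} {p : M}
    (hX : MDiffAt (T% X) (f p)) (hY : MDiffAt (T% Y) (f p)) (Z : Π x : N, TangentSpace 𝓘(ℝ, E') x) :
    mvfderiv 𝓘(ℝ, E) (fun y ↦ inner ℝ (horizontalLift E E' f X y) (horizontalLift E E' f Y y)) p
      (horizontalLift E E' f Z p) =
    mvfderiv 𝓘(ℝ, E') (fun y ↦ inner ℝ (X y) (Y y)) (f p) (Z (f p)) := by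
  have h : (fun y ↦ inner ℝ (horizontalLift E E' f X y) (horizontalLift E E' f Y y)) =
      (fun y ↦ (inner ℝ (X y) (Y y) : ℝ)) ∘ f :=
    funext fun y ↦ inner_adjoint_adjoint (hA y) _ _
  rw [h, mvfderiv_comp_apply p (mdifferentiableAt_inner hX hY)
    (hf.contMDiffAt.mdifferentiableAt (by simp)), horizontalLift, hA]

theorem koszul_horizontalLift {X Y Z : Π x : N, TangentSpace 𝓘(ℝ, E') x} {p : M}
    (hX : MDiffAt (T% X) (f p)) (hY : MDiffAt (T% Y) (f p)) (hZ : MDiffAt (T% Z) (f p)) :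
    koszul (horizontalLift E E' f X) (horizontalLift E E' f Y) (horizontalLift E E' f Z) p =
      koszul X Y Z (f p) := by
  unfold koszul
  rw [mvfderiv_inner_horizontalLift hf hA hY hZ, mvfderiv_inner_horizontalLift hf hA hX hZ,
    mvfderiv_inner_horizontalLift hf hA hX hY, inner_mlieBracket_horizontalLift hf hA hX hY,
    inner_mlieBracket_horizontalLift hf hA hX hZ, inner_mlieBracket_horizontalLift hf hA hY hZ]

/-- The horizontal part of the covariant derivative of a horizontal lift in a horizontal direction
projects to the covariant derivative on the base. -/
theorem mfderiv_leviCivita_horizontalLift {X : Π x : N, TangentSpace 𝓘(ℝ, E') x} {p : M}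
    (hX : MDiffAt (T% X) (f p)) (w : TangentSpace 𝓘(ℝ, E') (f p)) :
    mfderiv 𝓘(ℝ, E) 𝓘(ℝ, E') f p
      (leviCivita (horizontalLift E E' f X) p (adjointDeriv E E' f p w)) =
      leviCivita X (f p) w := by
  refine ext_inner_right ℝ fun z ↦ ?_
  have hw := mdifferentiableAt_extend_tangent w
  have hz := mdifferentiableAt_extend_tangent z
  have h1 := inner_leviCivita (mdifferentiableAt_horizontalLift hf hw)
    (mdifferentiableAt_horizontalLift hf hX) (mdifferentiableAt_horizontalLift hf hz)
  have h2 := inner_leviCivita hw hX hz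
  rw [koszul_horizontalLift hf hA hw hX hz, ← h2] at h1
  simp only [horizontalLift, extend_apply_self] at h1
  rw [real_inner_comm, ← adjointDeriv_inner_left, real_inner_comm]
  exact h1

end HorizontalLift

/-! ### Mean curvature of the fibers and the divergence of a lift. -/

section Distribution

variable {E : Type*} [NormedAddCommGroup E] [NormedSpace ℝ E] [FiniteDimensional ℝ E]
  {M : Type*} [TopologicalSpace M] [ChartedSpace E M] [IsManifold 𝓘(ℝ, E) ∞ M]
  [RiemannianBundle (fun x : M ↦ TangentSpace 𝓘(ℝ, E) x)]
  [IsContMDiffRiemannianBundle 𝓘(ℝ, E) ∞ E (fun x : M ↦ TangentSpace 𝓘(ℝ, E) x)]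

/-- The mean curvature vector of a distribution of tangent subspaces. -/
def distributionMeanCurvature (D : Π x : M, Submodule ℝ (TangentSpace 𝓘(ℝ, E) x)) (p : M) :
    TangentSpace 𝓘(ℝ, E) p :=
  ∑ i, (D p)ᗮ.starProjection
    (leviCivita (fun y ↦ (D y).starProjection
      (extend E (stdOrthonormalBasis ℝ (D p) i : TangentSpace 𝓘(ℝ, E) p) y)) p
      (stdOrthonormalBasis ℝ (D p) i))

theorem orbitMeanCurvature_eq {G : Type*} [Group G] [MulAction G M]
    {D : Π x : M, Submodule ℝ (TangentSpace 𝓘(ℝ, E) x)} (hD : ∀ x, orbitTangent E G x = D x)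
    (p : M) : orbitMeanCurvature E G p = distributionMeanCurvature D p := by
  obtain rfl : (fun x ↦ orbitTangent E G x) = D := funext hD
  rfl

variable {E' : Type*} [NormedAddCommGroup E'] [NormedSpace ℝ E'] [FiniteDimensional ℝ E']
  {N : Type*} [TopologicalSpace N] [ChartedSpace E' N] [IsManifold 𝓘(ℝ, E') ∞ N]
  [RiemannianBundle (fun x : N ↦ TangentSpace 𝓘(ℝ, E') x)]
  [IsContMDiffRiemannianBundle 𝓘(ℝ, E') ∞ E' (fun x : N ↦ TangentSpace 𝓘(ℝ, E') x)]
  {f : M → N} (hf : ContMDiff 𝓘(ℝ, E) 𝓘(ℝ, E') ∞ f)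
  (hA : ∀ (p : M) (w : TangentSpace 𝓘(ℝ, E') (f p)),
    mfderiv 𝓘(ℝ, E) 𝓘(ℝ, E') f p (adjointDeriv E E' f p w) = w)
include hf hA

theorem mdifferentiableAt_starProjection_ker {Z : Π x : M, TangentSpace 𝓘(ℝ, E) x} {p : M}
    (hZ : MDiffAt (T% Z) p) :
    MDiffAt (T% (fun y ↦ (mfderiv 𝓘(ℝ, E) 𝓘(ℝ, E') f y).ker.starProjection (Z y))) p := by
  have h : (fun y ↦ (mfderiv 𝓘(ℝ, E) 𝓘(ℝ, E') f y).ker.starProjection (Z y)) =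
      Z - fun y ↦ adjointDeriv E E' f y (mfderiv 𝓘(ℝ, E) 𝓘(ℝ, E') f y (Z y)) :=
    funext fun y ↦ starProjection_ker_apply (hA y) (Z y)
  have hd := mdifferentiableAt_sub_section hZ
    (mdifferentiableAt_adjointDeriv hf (mdifferentiableAt_mfderiv_apply hf hZ))
  rwa [← h] at hd

/-- Metric compatibility applied to the identically zero inner product of the lift with the vertical
projection of an extension of `e`. -/
theorem inner_leviCivita_horizontalLift_vertical {X : Π x : N, TangentSpace 𝓘(ℝ, E') x} {p : M}
    (hX : MDiffAt (T% X) (f p)) {e : TangentSpace 𝓘(ℝ, E) p}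
    (he : e ∈ (mfderiv 𝓘(ℝ, E) 𝓘(ℝ, E') f p).ker) :
    inner ℝ e (leviCivita (horizontalLift E E' f X) p e) =
      - inner ℝ (X (f p)) (mfderiv 𝓘(ℝ, E) 𝓘(ℝ, E') f p
        ((mfderiv 𝓘(ℝ, E) 𝓘(ℝ, E') f p).kerᗮ.starProjection
          (leviCivita (fun y ↦ (mfderiv 𝓘(ℝ, E) 𝓘(ℝ, E') f y).ker.starProjection
            (extend E e y)) p e))) := by
  have hE := mdifferentiableAt_extend_tangent e
  have h := leviCivita_metric hE (mdifferentiableAt_horizontalLift hf hX)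
    (mdifferentiableAt_starProjection_ker hf hA hE)
  have h0 : (fun y ↦ (inner ℝ (horizontalLift E E' f X y)
      ((mfderiv 𝓘(ℝ, E) 𝓘(ℝ, E') f y).ker.starProjection (extend E e y)) : ℝ)) = fun _ ↦ 0 := by
    funext y
    rw [horizontalLift, adjointDeriv_inner_left, show mfderiv 𝓘(ℝ, E) 𝓘(ℝ, E') f y
      ((mfderiv 𝓘(ℝ, E) 𝓘(ℝ, E') f y).ker.starProjection (extend E e y)) = 0 from
      (mfderiv 𝓘(ℝ, E) 𝓘(ℝ, E') f y).ker.starProjection_apply_mem _, inner_zero_right]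
  rw [h0, mvfderiv_const, extend_apply_self, Submodule.starProjection_eq_self_iff.2 he] at h
  rw [apply_starProjection_orthogonal_ker (hA p), ← adjointDeriv_inner_left, real_inner_comm]
  exact eq_neg_of_add_eq_zero_left h.symm

/-- The divergence of a horizontal lift. -/
theorem riemDiv_horizontalLift {X : Π x : N, TangentSpace 𝓘(ℝ, E') x} {p : M}
    (hX : MDiffAt (T% X) (f p)) :
    riemDiv E (horizontalLift E E' f X) p = riemDiv E' X (f p) -
      inner ℝ (X (f p)) (mfderiv 𝓘(ℝ, E) 𝓘(ℝ, E') f p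
        (distributionMeanCurvature (fun y ↦ (mfderiv 𝓘(ℝ, E) 𝓘(ℝ, E') f y).ker) p)) := by
  have h : mfderiv 𝓘(ℝ, E) 𝓘(ℝ, E') f p ∘L leviCivita (horizontalLift E E' f X) p ∘L
      ContinuousLinearMap.adjoint (mfderiv 𝓘(ℝ, E) 𝓘(ℝ, E') f p) = leviCivita X (f p) :=
    ContinuousLinearMap.ext fun w ↦ mfderiv_leviCivita_horizontalLift hf hA hX w
  rw [riemDiv, trace_eq_sum_ker_add_trace (hA p), h, distributionMeanCurvature, map_sum, inner_sum,
    add_comm, sub_eq_add_neg, ← Finset.sum_neg_distrib]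
  refine congrArg₂ _ rfl (Finset.sum_congr rfl fun i _ ↦ ?_)
  exact inner_leviCivita_horizontalLift_vertical hf hA hX (Subtype.property _)

/-- With trivial kernel the mean curvature is an empty sum. Applied to isometries of `M`, this is
the invariance of the divergence. -/
theorem riemDiv_horizontalLift_of_injective {X : Π x : N, TangentSpace 𝓘(ℝ, E') x} {p : M}
    (hX : MDiffAt (T% X) (f p)) (hi : Function.Injective (mfderiv 𝓘(ℝ, E) 𝓘(ℝ, E') f p)) :
    riemDiv E (horizontalLift E E' f X) p = riemDiv E' X (f p) := by
  rw [riemDiv_horizontalLift hf hA hX, distributionMeanCurvature]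
  have hk : (mfderiv 𝓘(ℝ, E) 𝓘(ℝ, E') f p).ker = ⊥ := LinearMap.ker_eq_bot.2 hi
  have hs : IsEmpty (Fin (Module.finrank ℝ (mfderiv 𝓘(ℝ, E) 𝓘(ℝ, E') f p).ker)) := by
    rw [hk, finrank_bot]
    infer_instance
  rw [Finset.univ_eq_empty, Finset.sum_empty, map_zero, inner_zero_right, sub_zero]

end Distribution

/-! ### Local sections and fiber curves of a submersion. -/

section Submersion

variable {E : Type*} [NormedAddCommGroup E] [NormedSpace ℝ E]
  {M : Type*} [TopologicalSpace M] [ChartedSpace E M] [IsManifold 𝓘(ℝ, E) ∞ M]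
  {E' : Type*} [NormedAddCommGroup E'] [NormedSpace ℝ E']
  {N : Type*} [TopologicalSpace N] [ChartedSpace E' N] [IsManifold 𝓘(ℝ, E') ∞ N]
  {f : M → N} {p : M}

theorem extend_apply_of_isSubmersionAt (h : IsSubmersionAt 𝓘(ℝ, E) 𝓘(ℝ, E') ∞ f p) {y : M}
    (hy : y ∈ h.domChart.source) :
    h.codChart.extend 𝓘(ℝ, E') (f y) = (h.equiv (h.domChart.extend 𝓘(ℝ, E) y)).1 := by
  have hy' : y ∈ (h.domChart.extend 𝓘(ℝ, E)).source := by
    rwa [OpenPartialHomeomorph.extend_source]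
  have := h.writtenInCharts ((h.domChart.extend 𝓘(ℝ, E)).map_source hy')
  simpa only [Function.comp_apply, (h.domChart.extend 𝓘(ℝ, E)).left_inv hy'] using this

theorem extend_target_mem_nhds_of_isSubmersionAt (h : IsSubmersionAt 𝓘(ℝ, E) 𝓘(ℝ, E') ∞ f p) :
    (h.domChart.extend 𝓘(ℝ, E)).target ∈ 𝓝 (h.domChart.extend 𝓘(ℝ, E) p) :=
  h.domChart.isOpen_extend_target.mem_nhds ((h.domChart.extend 𝓘(ℝ, E)).map_source
    (by rw [OpenPartialHomeomorph.extend_source]; exact h.mem_domChart_source))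

theorem contMDiffAt_extend_symm_of_isSubmersionAt (h : IsSubmersionAt 𝓘(ℝ, E) 𝓘(ℝ, E') ∞ f p) :
    ContMDiffAt 𝓘(ℝ, E) 𝓘(ℝ, E) ∞ (h.domChart.extend 𝓘(ℝ, E)).symm
      (h.domChart.extend 𝓘(ℝ, E) p) := by
  refine (contMDiffOn_extend_symm h.domChart_mem_maximalAtlas).contMDiffAt ?_
  rw [← OpenPartialHomeomorph.extend_target']
  exact extend_target_mem_nhds_of_isSubmersionAt h

/-- A submersion has a smooth local section through each point. -/
theorem exists_local_section_of_isSubmersionAt (h : IsSubmersionAt 𝓘(ℝ, E) 𝓘(ℝ, E') ∞ f p) :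
    ∃ σ : N → M, ContMDiffAt 𝓘(ℝ, E') 𝓘(ℝ, E) ∞ σ (f p) ∧ σ (f p) = p ∧
      ∀ᶠ q in 𝓝 (f p), f (σ q) = q := by
  set κ := h.domChart.extend 𝓘(ℝ, E) with hκ
  set ψ := h.codChart.extend 𝓘(ℝ, E') with hψ
  have hp : p ∈ κ.source := by
    rw [hκ, OpenPartialHomeomorph.extend_source]; exact h.mem_domChart_source
  -- The section keeps the complementary coordinate frozen at its value at `p`.
  let z : N → E := fun q ↦ h.equiv.symm (ψ q, (h.equiv (κ p)).2)
  have hz : z (f p) = κ p := by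
    simp only [z, hψ, extend_apply_of_isSubmersionAt h h.mem_domChart_source]
    exact h.equiv.symm_apply_apply _
  have hψs : ContMDiffAt 𝓘(ℝ, E') 𝓘(ℝ, E') ∞ ψ (f p) :=
    h.codChart.contMDiffAt_extend h.codChart_mem_maximalAtlas h.mem_codChart_source
  have hzs : ContMDiffAt 𝓘(ℝ, E') 𝓘(ℝ, E) ∞ z (f p) := by
    have h1 : ContDiff ℝ ∞ (fun x : E' ↦ h.equiv.symm (x, (h.equiv (κ p)).2)) :=
      h.equiv.symm.contDiff.comp (contDiff_id.prodMk contDiff_const)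
    exact h1.contMDiff.contMDiffAt.comp (f p) hψs
  refine ⟨κ.symm ∘ z, ?_, ?_, ?_⟩
  · have := contMDiffAt_extend_symm_of_isSubmersionAt h
    rw [← hκ, ← hz] at this
    exact this.comp (f p) hzs
  · rw [Function.comp_apply, hz, κ.left_inv hp]
  · have h1 : ∀ᶠ q in 𝓝 (f p), z q ∈ κ.target := by
      have := extend_target_mem_nhds_of_isSubmersionAt h
      rw [← hκ, ← hz] at this
      exact hzs.continuousAt.eventually_mem this
    filter_upwards [h1, h.codChart.open_source.mem_nhds h.mem_codChart_source] with q hq hq'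
    have hs : κ.symm (z q) ∈ h.domChart.source := by
      rw [← OpenPartialHomeomorph.extend_source (I := 𝓘(ℝ, E)) h.domChart]
      exact κ.map_target hq
    refine ψ.injOn ?_ ?_ ?_
    · rw [hψ, OpenPartialHomeomorph.extend_source]; exact h.source_subset_preimage_source hs
    · rwa [hψ, OpenPartialHomeomorph.extend_source]
    · rw [Function.comp_apply, hψ, extend_apply_of_isSubmersionAt h hs, ← hκ, κ.right_inv hq]
      simp [z, hψ]

theorem mfderiv_surjective_of_isSubmersionAt (h : IsSubmersionAt 𝓘(ℝ, E) 𝓘(ℝ, E') ∞ f p) :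
    Function.Surjective (mfderiv 𝓘(ℝ, E) 𝓘(ℝ, E') f p) := by
  obtain ⟨σ, hσ, hσp, hfσ⟩ := exists_local_section_of_isSubmersionAt h
  intro w
  have hf : MDifferentiableAt 𝓘(ℝ, E) 𝓘(ℝ, E') f (σ (f p)) := by
    rw [hσp]; exact h.contMDiffAt.mdifferentiableAt (by simp)
  have h1 := mfderiv_comp_apply (f p) hf (hσ.mdifferentiableAt (by simp)) w
  have h2 : mfderiv 𝓘(ℝ, E') 𝓘(ℝ, E') (f ∘ σ) (f p) = mfderiv 𝓘(ℝ, E') 𝓘(ℝ, E') id (f p) :=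
    Filter.EventuallyEq.mfderiv_eq hfσ
  refine ⟨(mfderiv 𝓘(ℝ, E') 𝓘(ℝ, E) σ (f p) w : E), ?_⟩
  have h3 : ∀ y, y = p → ∀ e : E, (mfderiv 𝓘(ℝ, E) 𝓘(ℝ, E') f y e : E') =
    (mfderiv 𝓘(ℝ, E) 𝓘(ℝ, E') f p e : E') := by
    rintro y rfl e; rfl
  refine (h3 _ hσp _).symm.trans (h1.symm.trans ?_)
  refine (DFunLike.congr_fun h2 w).trans ?_
  rw [mfderiv_id]
  rfl

/-- Each vector in the kernel of the differential of a submersion is the velocity of a curve in the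
fiber. -/
theorem exists_curve_of_mem_ker (h : IsSubmersionAt 𝓘(ℝ, E) 𝓘(ℝ, E') ∞ f p)
    {w : TangentSpace 𝓘(ℝ, E) p} (hw : mfderiv 𝓘(ℝ, E) 𝓘(ℝ, E') f p w = 0) :
    ∃ γ : ℝ → M, ContMDiffAt 𝓘(ℝ, ℝ) 𝓘(ℝ, E) 1 γ 0 ∧ (∀ᶠ t in 𝓝 (0 : ℝ), f (γ t) = f p) ∧
      (⟨p, w⟩ : TangentBundle 𝓘(ℝ, E) M) = ⟨γ 0, mfderiv 𝓘(ℝ, ℝ) 𝓘(ℝ, E) γ 0 (1 : ℝ)⟩ := by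
  set κ := h.domChart.extend 𝓘(ℝ, E) with hκ
  set ψ := h.codChart.extend 𝓘(ℝ, E') with hψ
  have hp : p ∈ κ.source := by
    rw [hκ, OpenPartialHomeomorph.extend_source]; exact h.mem_domChart_source
  have hκs : MDifferentiableAt 𝓘(ℝ, E) 𝓘(ℝ, E) κ p :=
    (h.domChart.contMDiffAt_extend h.domChart_mem_maximalAtlas
      h.mem_domChart_source).mdifferentiableAt (n := ∞) (by simp)
  have hψs : MDifferentiableAt 𝓘(ℝ, E') 𝓘(ℝ, E') ψ (f p) :=
    (h.codChart.contMDiffAt_extend h.codChart_mem_maximalAtlas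
      h.mem_codChart_source).mdifferentiableAt (n := ∞) (by simp)
  have hκ' : ContMDiffAt 𝓘(ℝ, E) 𝓘(ℝ, E) ∞ κ.symm (κ p) :=
    contMDiffAt_extend_symm_of_isSubmersionAt h
  let c : E := mfderiv 𝓘(ℝ, E) 𝓘(ℝ, E) κ p w
  -- In the charts `f` is the first projection, so a kernel vector has no base component and the
  -- line through `κ p` in direction `c` stays in the fiber.
  have hc : (h.equiv c).1 = 0 := by
    have e1 : ψ ∘ f =ᶠ[𝓝 p] ((ContinuousLinearMap.fst ℝ E' h.complement).comp
        (h.equiv : E →L[ℝ] E' × h.complement)) ∘ κ := by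
      filter_upwards [h.domChart.open_source.mem_nhds h.mem_domChart_source] with y hy
      exact extend_apply_of_isSubmersionAt h hy
    have e2 := DFunLike.congr_fun (e1.mfderiv_eq (I := 𝓘(ℝ, E)) (I' := 𝓘(ℝ, E'))) w
    have e3 := mfderiv_comp_apply p hψs (h.contMDiffAt.mdifferentiableAt (by simp)) w
    have e4 := mfderiv_comp_apply p (((ContinuousLinearMap.fst ℝ E' h.complement).comp
        (h.equiv : E →L[ℝ] E' × h.complement)).differentiableAt.mdifferentiableAt) hκs w
    rw [hw, map_zero] at e3
    rw [mfderiv_eq_fderiv, ContinuousLinearMap.fderiv] at e4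
    exact e4.symm.trans (e2.symm.trans e3)
  let ℓ : ℝ → E := fun t ↦ κ p + t • c
  have hℓ0 : ℓ 0 = κ p := by simp [ℓ]
  have hℓ : ContDiff ℝ ∞ ℓ := contDiff_const.add (contDiff_id.smul contDiff_const)
  have hℓd : HasDerivAt ℓ c 0 := by
    have := ((hasDerivAt_id (0 : ℝ)).smul_const c).const_add (κ p)
    rwa [one_smul] at this
  have hκℓ : ContMDiffAt 𝓘(ℝ, E) 𝓘(ℝ, E) ∞ κ.symm (ℓ 0) := by rwa [hℓ0]
  refine ⟨κ.symm ∘ ℓ, ?_, ?_, ?_⟩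
  · exact (hκℓ.comp (0 : ℝ) hℓ.contMDiff.contMDiffAt).of_le (by norm_cast)
  · have h1 : ∀ᶠ t in 𝓝 (0 : ℝ), ℓ t ∈ κ.target := by
      have := extend_target_mem_nhds_of_isSubmersionAt h
      rw [← hκ, ← hℓ0] at this
      exact hℓ.continuous.continuousAt.eventually_mem this
    filter_upwards [h1] with t ht
    have hs : κ.symm (ℓ t) ∈ h.domChart.source := by
      rw [← OpenPartialHomeomorph.extend_source (I := 𝓘(ℝ, E)) h.domChart]
      exact κ.map_target ht
    refine ψ.injOn ?_ ?_ ?_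
    · rw [hψ, OpenPartialHomeomorph.extend_source]; exact h.source_subset_preimage_source hs
    · rw [hψ, OpenPartialHomeomorph.extend_source]; exact h.mem_codChart_source
    · rw [Function.comp_apply, hψ, extend_apply_of_isSubmersionAt h hs,
        extend_apply_of_isSubmersionAt h h.mem_domChart_source, ← hκ, κ.right_inv ht]
      simp [ℓ, hc]
  -- The velocity is w because `κ.symm ∘ κ` is the identity near `p`. Points of the tangent bundle
  -- are compared, since the base points are equal only propositionally.
  · have h1 : tangentMap 𝓘(ℝ, ℝ) 𝓘(ℝ, E) (κ.symm ∘ ℓ) ⟨0, (1 : ℝ)⟩ =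
        tangentMap 𝓘(ℝ, E) 𝓘(ℝ, E) κ.symm (tangentMap 𝓘(ℝ, ℝ) 𝓘(ℝ, E) ℓ ⟨0, (1 : ℝ)⟩) :=
      tangentMap_comp_at (I' := 𝓘(ℝ, E)) _ (hκℓ.mdifferentiableAt (by simp))
        hℓd.differentiableAt.mdifferentiableAt
    have h2 : tangentMap 𝓘(ℝ, ℝ) 𝓘(ℝ, E) ℓ ⟨0, (1 : ℝ)⟩ =
        tangentMap 𝓘(ℝ, E) 𝓘(ℝ, E) κ ⟨p, w⟩ := by
      have hd : (mfderiv 𝓘(ℝ, ℝ) 𝓘(ℝ, E) ℓ 0 (1 : ℝ) : E) = c := by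
        rw [mfderiv_eq_fderiv, hℓd.hasFDerivAt.fderiv]
        exact one_smul ℝ c
      have ht : ∀ x y : E, x = y → ∀ a b : E, a = b →
          (⟨x, a⟩ : TangentBundle 𝓘(ℝ, E) E) = ⟨y, b⟩ := by
        rintro x _ rfl a _ rfl; rfl
      exact ht _ _ hℓ0 _ _ hd
    have h3 : tangentMap 𝓘(ℝ, E) 𝓘(ℝ, E) (κ.symm ∘ κ) ⟨p, w⟩ =
        tangentMap 𝓘(ℝ, E) 𝓘(ℝ, E) κ.symm (tangentMap 𝓘(ℝ, E) 𝓘(ℝ, E) κ ⟨p, w⟩) :=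
      tangentMap_comp_at (I' := 𝓘(ℝ, E)) _ (hκ'.mdifferentiableAt (by simp)) hκs
    have e : κ.symm ∘ κ =ᶠ[𝓝 p] id := by
      filter_upwards [h.domChart.open_source.mem_nhds h.mem_domChart_source] with y hy
      refine κ.left_inv ?_
      rwa [hκ, OpenPartialHomeomorph.extend_source]
    have h4 : tangentMap 𝓘(ℝ, E) 𝓘(ℝ, E) (κ.symm ∘ κ) ⟨p, w⟩ = ⟨p, w⟩ := by
      have ht : ∀ g : M → M, g =ᶠ[𝓝 p] id →
          tangentMap 𝓘(ℝ, E) 𝓘(ℝ, E) g ⟨p, w⟩ = tangentMap 𝓘(ℝ, E) 𝓘(ℝ, E) id ⟨p, w⟩ := by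
        intro g hg
        have hx : ∀ (x y : M), x = y → ∀ a b : E, a = b →
            (⟨x, a⟩ : TangentBundle 𝓘(ℝ, E) M) = ⟨y, b⟩ := by
          rintro x _ rfl a _ rfl; rfl
        exact hx _ _ hg.self_of_nhds _ _
          (DFunLike.congr_fun (hg.mfderiv_eq (I := 𝓘(ℝ, E)) (I' := 𝓘(ℝ, E))) w)
      rw [ht _ e, tangentMap_id]
      rfl
    rw [← h2, ← h1, h4] at h3
    exact h3

/-- The differential vanishes on the velocity of a curve in a fiber. -/
theorem mfderiv_eq_zero_of_curve (hf : MDifferentiable 𝓘(ℝ, E) 𝓘(ℝ, E') f) {γ : ℝ → M}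
    (hγ : MDifferentiableAt 𝓘(ℝ, ℝ) 𝓘(ℝ, E) γ 0) {q : N} (hq : ∀ᶠ t in 𝓝 (0 : ℝ), f (γ t) = q)
    {w : TangentSpace 𝓘(ℝ, E) p}
    (hw : (⟨p, w⟩ : TangentBundle 𝓘(ℝ, E) M) = ⟨γ 0, mfderiv 𝓘(ℝ, ℝ) 𝓘(ℝ, E) γ 0 (1 : ℝ)⟩) :
    mfderiv 𝓘(ℝ, E) 𝓘(ℝ, E') f p w = 0 := by
  obtain ⟨h1, h2⟩ := Bundle.TotalSpace.mk.inj hw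
  subst h1
  obtain rfl := eq_of_heq h2
  have e : f ∘ γ =ᶠ[𝓝 0] fun _ ↦ q := hq
  have h3 := mfderiv_comp_apply (0 : ℝ) (hf (γ 0)) hγ (1 : ℝ)
  refine h3.symm.trans ((DFunLike.congr_fun
    (e.mfderiv_eq (I := 𝓘(ℝ, ℝ)) (I' := 𝓘(ℝ, E'))) (1 : ℝ)).trans ?_)
  rw [mfderiv_const]
  rfl

end Submersion

/-! ### Gradients, fluxes and descent to the base. -/

section Lift

variable {E : Type*} [NormedAddCommGroup E] [NormedSpace ℝ E] [FiniteDimensional ℝ E]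
  {M : Type*} [TopologicalSpace M] [ChartedSpace E M] [IsManifold 𝓘(ℝ, E) ∞ M]
  [RiemannianBundle (fun x : M ↦ TangentSpace 𝓘(ℝ, E) x)]
  {E' : Type*} [NormedAddCommGroup E'] [NormedSpace ℝ E'] [FiniteDimensional ℝ E']
  {N : Type*} [TopologicalSpace N] [ChartedSpace E' N] [IsManifold 𝓘(ℝ, E') ∞ N]
  [RiemannianBundle (fun x : N ↦ TangentSpace 𝓘(ℝ, E') x)]

/-- The chain rule, read through adjoints. -/
theorem horizontalLift_comp {f : M → N} (hf : MDifferentiable 𝓘(ℝ, E) 𝓘(ℝ, E') f) {τ : M → M}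
    (hτ : MDifferentiable 𝓘(ℝ, E) 𝓘(ℝ, E) τ) (X : Π x : N, TangentSpace 𝓘(ℝ, E') x) :
    horizontalLift E E' (f ∘ τ) X = horizontalLift E E τ (horizontalLift E E' f X) := by
  funext p
  refine ext_inner_right ℝ fun w ↦ ?_
  have h1 := adjointDeriv_inner_left (E := E) (E' := E') (f ∘ τ) p (X (f (τ p))) w
  have h2 := adjointDeriv_inner_left (E := E) (E' := E) τ p (horizontalLift E E' f X (τ p)) w
  have h3 := adjointDeriv_inner_left (E := E) (E' := E') f (τ p) (X (f (τ p)))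
    (mfderiv 𝓘(ℝ, E) 𝓘(ℝ, E) τ p w)
  have h4 := mfderiv_comp_apply p (hf (τ p)) (hτ p) w
  exact h1.trans ((congrArg (fun z : TangentSpace 𝓘(ℝ, E') (f (τ p)) ↦
    (inner ℝ (X (f (τ p))) z : ℝ)) h4).trans (h3.symm.trans h2.symm))

section Gradient

variable {f : M → N} {u : M → ℝ} {v : N → ℝ} {p : M}

theorem riemGrad_eq_horizontalLift (hf : MDifferentiable 𝓘(ℝ, E) 𝓘(ℝ, E') f)
    (hv : MDifferentiableAt 𝓘(ℝ, E') 𝓘(ℝ, ℝ) v (f p)) (huv : u =ᶠ[𝓝 p] v ∘ f) :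
    riemGrad E u p = horizontalLift E E' f (riemGrad E' v) p := by
  refine ext_inner_right ℝ fun w ↦ ?_
  rw [horizontalLift, adjointDeriv_inner_left, riemGrad, riemGrad,
    InnerProductSpace.toDual_symm_apply, InnerProductSpace.toDual_symm_apply, mvfderiv_congr huv,
    mvfderiv_comp_apply p hv (hf p)]

variable (hA : ∀ (p : M) (w : TangentSpace 𝓘(ℝ, E') (f p)),
  mfderiv 𝓘(ℝ, E) 𝓘(ℝ, E') f p (adjointDeriv E E' f p w) = w)
include hA

theorem norm_riemGrad_eq (hf : MDifferentiable 𝓘(ℝ, E) 𝓘(ℝ, E') f)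
    (hv : MDifferentiableAt 𝓘(ℝ, E') 𝓘(ℝ, ℝ) v (f p)) (huv : u =ᶠ[𝓝 p] v ∘ f) :
    ‖riemGrad E u p‖ = ‖riemGrad E' v (f p)‖ := by
  rw [riemGrad_eq_horizontalLift hf hv huv]
  exact norm_adjoint_apply (hA p) _

theorem fluxField_eq_horizontalLift (a : ℝ → ℝ) (hf : MDifferentiable 𝓘(ℝ, E) 𝓘(ℝ, E') f)
    (hv : MDifferentiableAt 𝓘(ℝ, E') 𝓘(ℝ, ℝ) v (f p)) (huv : u =ᶠ[𝓝 p] v ∘ f) :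
    fluxField E a u p = horizontalLift E E' f (fluxField E' a v) p := by
  rw [fluxField, norm_riemGrad_eq hA hf hv huv, riemGrad_eq_horizontalLift hf hv huv]
  simp only [horizontalLift, fluxField, map_smul]

end Gradient

variable [IsContMDiffRiemannianBundle 𝓘(ℝ, E) ∞ E (fun x : M ↦ TangentSpace 𝓘(ℝ, E) x)]

theorem mdifferentiableAt_section_congr {X Y : Π x : M, TangentSpace 𝓘(ℝ, E) x} {p : M}
    (h : ∀ᶠ y in 𝓝 p, X y = Y y) : MDiffAt (T% X) p ↔ MDiffAt (T% Y) p := by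
  have e : (T% X) =ᶠ[𝓝 p] (T% Y) := by
    filter_upwards [h] with y hy
    rw [hy]
  exact ⟨fun hX ↦ hX.congr_of_eventuallyEq e.symm, fun hY ↦ hY.congr_of_eventuallyEq e⟩

theorem riemDiv_congr {X Y : Π x : M, TangentSpace 𝓘(ℝ, E) x} {p : M}
    (hX : MDiffAt (T% X) p) (h : ∀ᶠ y in 𝓝 p, X y = Y y) : riemDiv E X p = riemDiv E Y p := by
  rw [riemDiv, riemDiv, leviCivita.isCovariantDerivativeOnUniv.congr_of_eventuallyEq hX
    ((mdifferentiableAt_section_congr h).1 hX) univ_mem h]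

variable [IsContMDiffRiemannianBundle 𝓘(ℝ, E') ∞ E' (fun x : N ↦ TangentSpace 𝓘(ℝ, E') x)]
  {f : M → N} (hf : ContMDiff 𝓘(ℝ, E) 𝓘(ℝ, E') ∞ f)
  (hA : ∀ (p : M) (w : TangentSpace 𝓘(ℝ, E') (f p)),
    mfderiv 𝓘(ℝ, E) 𝓘(ℝ, E') f p (adjointDeriv E E' f p w) = w)
include hf hA

/-- For the descent, `X` is recovered near `f p` by pushing the lift forward along a local section
of `f` through `p`. -/
theorem mdifferentiableAt_horizontalLift_iff {X : Π x : N, TangentSpace 𝓘(ℝ, E') x} {p : M}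
    (hp : IsSubmersionAt 𝓘(ℝ, E) 𝓘(ℝ, E') ∞ f p) :
    MDiffAt (T% (horizontalLift E E' f X)) p ↔ MDiffAt (T% X) (f p) := by
  refine ⟨fun h ↦ ?_, mdifferentiableAt_horizontalLift hf⟩
  obtain ⟨σ, hσ, hσp, hfσ⟩ := exists_local_section_of_isSubmersionAt hp
  have h1 := mdifferentiableAt_mfderiv_apply hf h
  rw [← hσp] at h1
  refine (h1.comp (f p) (hσ.mdifferentiableAt (by simp))).congr_of_eventuallyEq ?_
  filter_upwards [hfσ] with q hq
  have h2 : ∀ q', q' = q → (⟨q, X q⟩ : TangentBundle 𝓘(ℝ, E') N) = ⟨q', X q'⟩ := by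
    rintro _ rfl; rfl
  refine (h2 _ hq).trans ?_
  exact congrArg (fun z : TangentSpace 𝓘(ℝ, E') (f (σ q)) ↦
    (⟨f (σ q), z⟩ : TangentBundle 𝓘(ℝ, E') N)) (hA (σ q) (X (f (σ q)))).symm

/-- The projected mean curvature vector of the fibers takes the same value at `p` and at `τ p` for
an isometry `τ` that preserves the fibers. -/
theorem mfderiv_meanCurvature_eq_of_isometry {τ : M → M} (hτ : ContMDiff 𝓘(ℝ, E) 𝓘(ℝ, E) ∞ τ)
    (hτA : ∀ (p : M) (w : TangentSpace 𝓘(ℝ, E) (τ p)),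
      mfderiv 𝓘(ℝ, E) 𝓘(ℝ, E) τ p (adjointDeriv E E τ p w) = w)
    (hi : ∀ p, Function.Injective (mfderiv 𝓘(ℝ, E) 𝓘(ℝ, E) τ p)) (hfτ : f ∘ τ = f) (p : M) :
    (⟨f (τ p), mfderiv 𝓘(ℝ, E) 𝓘(ℝ, E') f (τ p)
      (distributionMeanCurvature (fun y ↦ (mfderiv 𝓘(ℝ, E) 𝓘(ℝ, E') f y).ker) (τ p))⟩ :
        TangentBundle 𝓘(ℝ, E') N) =
      ⟨f p, mfderiv 𝓘(ℝ, E) 𝓘(ℝ, E') f p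
        (distributionMeanCurvature (fun y ↦ (mfderiv 𝓘(ℝ, E) 𝓘(ℝ, E') f y).ker) p)⟩ := by
  have hfp : f (τ p) = f p := congrFun hfτ p
  -- The functional sending X to div X − ⟨X, k⟩ determines k, as X may take any value at the point.
  -- This avoids transporting orthonormal frames by `τ`.
  have hmain : ∀ (q q' : N) (_ : q = q') (k : TangentSpace 𝓘(ℝ, E') q)
      (k' : TangentSpace 𝓘(ℝ, E') q')
      (_ : ∀ X : Π x : N, TangentSpace 𝓘(ℝ, E') x, MDiffAt (T% X) q →
        riemDiv E' X q - inner ℝ (X q) k = riemDiv E' X q' - inner ℝ (X q') k'),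
      (⟨q, k⟩ : TangentBundle 𝓘(ℝ, E') N) = ⟨q', k'⟩ := by
    rintro q _ rfl k k' h
    congr 1
    refine ext_inner_left ℝ fun w ↦ ?_
    have := h _ (mdifferentiableAt_extend_tangent w)
    rw [extend_apply_self] at this
    linarith
  refine hmain _ _ hfp _ _ fun X hX ↦ ?_
  have hX' : MDiffAt (T% X) (f p) := by rwa [← hfp]
  -- Both sides are divergences of the lift of `X`, at `τ p` and at `p`. Lifting by `f` and then by
  -- `τ` is lifting by `f ∘ τ = f`, and the lift by `τ` keeps the divergence.
  rw [← riemDiv_horizontalLift hf hA hX, ← riemDiv_horizontalLift hf hA hX',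
    ← riemDiv_horizontalLift_of_injective hτ hτA (mdifferentiableAt_horizontalLift hf hX) (hi p),
    ← horizontalLift_comp (hf.mdifferentiable (by simp)) (hτ.mdifferentiable (by simp)), hfτ]

end Lift

/-- A field along a surjective map that is constant along the fibers descends to the base. -/
theorem exists_section_of_fiberwise_const {B A F : Type*} {V : B → Type*} {f : A → B}
    (hs : Function.Surjective f) (K : ∀ p, V (f p))
    (hK : ∀ p p', f p = f p' → (⟨f p, K p⟩ : TotalSpace F V) = ⟨f p', K p'⟩) :
    ∃ J : ∀ q, V q, ∀ p, K p = J (f p) := by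
  have h : ∀ q, ∃ j : V q, ∀ p, f p = q → (⟨f p, K p⟩ : TotalSpace F V) = ⟨q, j⟩ := by
    intro q
    obtain ⟨p, rfl⟩ := hs q
    exact ⟨K p, fun p' hp' ↦ hK p' p hp'⟩
  choose J hJ using h
  exact ⟨J, fun p ↦ eq_of_heq (TotalSpace.mk.inj (hJ _ p rfl)).2⟩

/-! ### The orbit space and its projection. -/

section OrbitSpace

theorem orbitProj_eq_iff {M G : Type*} [Group G] [MulAction G M] {x p : M} :
    orbitProj G x = orbitProj G p ↔ x ∈ MulAction.orbit G p :=
  Quotient.eq''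

theorem orbitProj_smul {M G : Type*} [Group G] [MulAction G M] (g : G) (p : M) :
    orbitProj G (g • p) = orbitProj G p :=
  orbitProj_eq_iff.2 (MulAction.mem_orbit p g)

theorem isOpenQuotientMap_orbitProj {M G : Type*} [Group G] [MulAction G M] [TopologicalSpace M]
    [ContinuousConstSMul G M] : IsOpenQuotientMap (orbitProj G : M → _) :=
  MulAction.isOpenQuotientMap_quotientMk

theorem orbitProj_preimage_image {M G : Type*} [Group G] [MulAction G M] {Ω : Set M}
    (hΩ : ∀ (g : G), ∀ p ∈ Ω, g • p ∈ Ω) : orbitProj G ⁻¹' (orbitProj G '' Ω) = Ω := by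
  refine Subset.antisymm ?_ (subset_preimage_image _ _)
  rintro p ⟨x, hx, hxp⟩
  obtain ⟨g, rfl⟩ := orbitProj_eq_iff.1 hxp.symm
  exact hΩ g x hx

variable {E : Type*} [NormedAddCommGroup E] [NormedSpace ℝ E] [FiniteDimensional ℝ E]
  {M : Type*} [TopologicalSpace M] [ChartedSpace E M] [IsManifold 𝓘(ℝ, E) ∞ M]
  {G : Type*} [Group G] [MulAction G M]
  {E' : Type*} [NormedAddCommGroup E'] [NormedSpace ℝ E'] [FiniteDimensional ℝ E']
  [ChartedSpace E' (MulAction.orbitRel.Quotient G M)]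
  [IsManifold 𝓘(ℝ, E') ∞ (MulAction.orbitRel.Quotient G M)]

/-- Orbits are the fibers of the projection: velocities of curves in a fiber are killed by the
differential, and every kernel vector is such a velocity. -/
theorem orbitTangent_eq_ker (h : IsSubmersion 𝓘(ℝ, E) 𝓘(ℝ, E') ∞ (orbitProj G : M → _)) (p : M) :
    orbitTangent E G p = (mfderiv 𝓘(ℝ, E) 𝓘(ℝ, E') (orbitProj G) p).ker := by
  refine le_antisymm (Submodule.span_le.2 ?_) fun w hw ↦ Submodule.subset_span ?_
  · rintro w ⟨γ, hγ, hγo, hw⟩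
    exact mfderiv_eq_zero_of_curve (h.contMDiff.mdifferentiable (by simp))
      (hγ.mdifferentiableAt one_ne_zero) (hγo.mono fun t ht ↦ orbitProj_eq_iff.2 ht) hw
  · obtain ⟨γ, hγ, hγo, hw'⟩ := exists_curve_of_mem_ker (h.isSubmersionAt p) hw
    exact ⟨γ, hγ, hγo.mono fun t ht ↦ orbitProj_eq_iff.1 ht, hw'⟩

/-- Preserving inner products gives injectivity, equality of dimensions gives surjectivity, and the
adjoint of a surjective isometry inverts it. -/
theorem adjointDeriv_smul_right_inverse {EG : Type*} [NormedAddCommGroup EG] [NormedSpace ℝ EG]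
    [TopologicalSpace G] [ChartedSpace EG G] [ContMDiffSMul 𝓘(ℝ, EG) 𝓘(ℝ, E) ∞ G M]
    [RiemannianBundle (fun x : M ↦ TangentSpace 𝓘(ℝ, E) x)] (g : G)
    (hisom : ∀ (p : M) (v w : TangentSpace 𝓘(ℝ, E) p),
      inner ℝ (mfderiv 𝓘(ℝ, E) 𝓘(ℝ, E) (fun q : M ↦ g • q) p v)
        (mfderiv 𝓘(ℝ, E) 𝓘(ℝ, E) (fun q : M ↦ g • q) p w) = inner ℝ v w) (p : M) :
    Function.Injective (mfderiv 𝓘(ℝ, E) 𝓘(ℝ, E) (fun q : M ↦ g • q) p) ∧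
    ∀ w : TangentSpace 𝓘(ℝ, E) (g • p), mfderiv 𝓘(ℝ, E) 𝓘(ℝ, E) (fun q : M ↦ g • q) p
      (adjointDeriv E E (fun q : M ↦ g • q) p w) = w := by
  have hi : Function.Injective (mfderiv 𝓘(ℝ, E) 𝓘(ℝ, E) (fun q : M ↦ g • q) p) := by
    refine (injective_iff_map_eq_zero _).2 fun v hv ↦ ?_
    have := hisom p v v
    rw [hv, inner_zero_left] at this
    exact inner_self_eq_zero.1 this.symm
  have hs : Function.Surjective (mfderiv 𝓘(ℝ, E) 𝓘(ℝ, E) (fun q : M ↦ g • q) p) :=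
    (LinearMap.injective_iff_surjective_of_finrank_eq_finrank
      (f := (mfderiv 𝓘(ℝ, E) 𝓘(ℝ, E) (fun q : M ↦ g • q) p).toLinearMap) rfl).1 hi
  exact ⟨hi, fun w ↦ apply_adjoint_of_surjective_of_inner_map hs
    (fun v _ w _ ↦ hisom p v w) w⟩

end OrbitSpace

end

/-! ### The reduction theorem. -/

theorem mainTheorem5
    -- the complete Riemannian manifold `M`
    {E : Type*} [NormedAddCommGroup E] [NormedSpace ℝ E] [FiniteDimensional ℝ E]
    {M : Type*} [EMetricSpace M] [ChartedSpace E M] [IsManifold 𝓘(ℝ, E) ∞ M]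
    [RiemannianBundle (fun x : M ↦ TangentSpace 𝓘(ℝ, E) x)]
    [IsContMDiffRiemannianBundle 𝓘(ℝ, E) ∞ E (fun x : M ↦ TangentSpace 𝓘(ℝ, E) x)]
    [IsRiemannianManifold 𝓘(ℝ, E) M] [CompleteSpace M]
    -- the Lie group `G`, acting smoothly, freely and properly on `M` by isometries
    {EG : Type*} [NormedAddCommGroup EG] [NormedSpace ℝ EG] [FiniteDimensional ℝ EG]
    {G : Type*} [Group G] [TopologicalSpace G] [ChartedSpace EG G] [LieGroup 𝓘(ℝ, EG) ∞ G]
    [MulAction G M] [ContMDiffSMul 𝓘(ℝ, EG) 𝓘(ℝ, E) ∞ G M] [ProperSMul G M]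
    (hfree : ∀ (g : G) (p : M), g • p = p → g = 1)
    (hisom : ∀ (g : G) (p : M) (v w : TangentSpace 𝓘(ℝ, E) p),
      inner ℝ (mfderiv 𝓘(ℝ, E) 𝓘(ℝ, E) (fun q : M ↦ g • q) p v)
        (mfderiv 𝓘(ℝ, E) 𝓘(ℝ, E) (fun q : M ↦ g • q) p w) = inner ℝ v w)
    -- the orbit space `M / G` with the quotient topology, the smooth structure for which the
    -- projection is a submersion and the metric for which it is a Riemannian submersion
    {E' : Type*} [NormedAddCommGroup E'] [NormedSpace ℝ E'] [FiniteDimensional ℝ E']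
    [ChartedSpace E' (MulAction.orbitRel.Quotient G M)]
    [IsManifold 𝓘(ℝ, E') ∞ (MulAction.orbitRel.Quotient G M)]
    [RiemannianBundle (fun q : MulAction.orbitRel.Quotient G M ↦ TangentSpace 𝓘(ℝ, E') q)]
    [IsContMDiffRiemannianBundle 𝓘(ℝ, E') ∞ E'
      (fun q : MulAction.orbitRel.Quotient G M ↦ TangentSpace 𝓘(ℝ, E') q)]
    (hπ : IsRiemannianSubmersion (E := E) (E' := E') (orbitProj G : M → _))
    -- the function `a`
    (a : ℝ → ℝ) (ha : ContinuousOn a (Ici 0)) (ha1 : ContDiffOn ℝ 1 a (Ioi 0))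
    (ha_pos : ∀ s, 0 < s → 0 < a s) (ha_deriv : ∀ s, 0 < s → 0 < deriv a s)
    -- the invariant domain `Ω` and the functions `u`, `φ`, `v`, `ψ`
    (Ω : Set M) (hΩ : IsC2Domain E Ω) (hΩ_inv : ∀ (g : G), ∀ p ∈ Ω, g • p ∈ Ω)
    (Λ : Set (MulAction.orbitRel.Quotient G M)) (hΛ : Λ = orbitProj G '' Ω)
    (u φ : M → ℝ) (v ψ : MulAction.orbitRel.Quotient G M → ℝ)
    (hu : ContMDiffOn 𝓘(ℝ, E) 𝓘(ℝ, ℝ) 2 u Ω) (hu0 : ContinuousOn u (closure Ω))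
    (hu_inv : ∀ (g : G), ∀ p ∈ closure Ω, u (g • p) = u p)
    (hφ : ContinuousOn φ (frontier Ω)) (hφ_inv : ∀ (g : G), ∀ p ∈ frontier Ω, φ (g • p) = φ p)
    (hv : ContMDiffOn 𝓘(ℝ, E') 𝓘(ℝ, ℝ) 2 v Λ) (hv0 : ContinuousOn v (closure Λ))
    (hψ : ContinuousOn ψ (frontier Λ))
    (huv : ∀ p ∈ closure Ω, u p = v (orbitProj G p))
    (hφψ : ∀ p ∈ frontier Ω, φ p = ψ (orbitProj G p)) :
    -- the mean curvature vector field of the orbits projects to a vector field `J` on `M / G`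
    ∃ J : Π q : MulAction.orbitRel.Quotient G M, TangentSpace 𝓘(ℝ, E') q,
      (∀ p : M, mfderiv 𝓘(ℝ, E) 𝓘(ℝ, E') (orbitProj G) p (orbitMeanCurvature E G p) =
        J (orbitProj G p)) ∧
      (∀ p ∈ Ω, a ‖riemGrad E u p‖ / ‖riemGrad E u p‖ =
        a ‖riemGrad E' v (orbitProj G p)‖ / ‖riemGrad E' v (orbitProj G p)‖) ∧
      (SolvesDirichlet E a Ω φ u ↔ SolvesDirichletWithDrift E' a J Λ ψ v) := by
  have hcs : ContinuousSMul G M := ContMDiffSMul.continuousSMul (I := 𝓘(ℝ, EG)) (I' := 𝓘(ℝ, E)) ∞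
  have hq : IsOpenQuotientMap (orbitProj G : M → _) := isOpenQuotientMap_orbitProj
  have hf : ContMDiff 𝓘(ℝ, E) 𝓘(ℝ, E') ∞ (orbitProj G : M → _) := hπ.isSubmersion.contMDiff
  have hfd : MDifferentiable 𝓘(ℝ, E) 𝓘(ℝ, E') (orbitProj G : M → _) :=
    hf.mdifferentiable (by simp)
  have hA : ∀ (p : M) (w : TangentSpace 𝓘(ℝ, E') (orbitProj G p)),
      mfderiv 𝓘(ℝ, E) 𝓘(ℝ, E') (orbitProj G) p (adjointDeriv E E' (orbitProj G) p w) = w :=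
    fun p ↦ apply_adjoint_of_surjective_of_inner_map
      (mfderiv_surjective_of_isSubmersionAt (hπ.isSubmersion.isSubmersionAt p)) (hπ.inner_map p)
  have hH := orbitMeanCurvature_eq (orbitTangent_eq_ker hπ.isSubmersion)
  obtain ⟨J, hJ⟩ := exists_section_of_fiberwise_const (F := E')
    (V := fun q : MulAction.orbitRel.Quotient G M ↦ TangentSpace 𝓘(ℝ, E') q) hq.surjective
    (fun p ↦ mfderiv 𝓘(ℝ, E) 𝓘(ℝ, E') (orbitProj G) p (orbitMeanCurvature E G p)) (by
      intro x p hxp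
      obtain ⟨g, rfl⟩ := orbitProj_eq_iff.1 hxp
      have h := fun p ↦ adjointDeriv_smul_right_inverse (EG := EG) g (hisom g) p
      simp only [hH]
      exact mfderiv_meanCurvature_eq_of_isometry hf hA
        (ContMDiffSMul.contMDiff_const_smul (I := 𝓘(ℝ, EG)) g) (fun p ↦ (h p).2)
        (fun p ↦ (h p).1) (funext fun p ↦ orbitProj_smul g p) p)
  have hΩΛ : orbitProj G ⁻¹' Λ = Ω := by rw [hΛ, orbitProj_preimage_image hΩ_inv]
  have hΛo : IsOpen Λ := by rw [hΛ]; exact hq.isOpenMap _ hΩ.isOpen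
  -- Openness of the projection lets frontiers pull back, which is what matches the two boundary
  -- conditions.
  have hfr : orbitProj G ⁻¹' frontier Λ = frontier Ω := by
    rw [hq.isOpenMap.preimage_frontier_eq_frontier_preimage hq.continuous, hΩΛ]
  have hmem : ∀ p, orbitProj G p ∈ Λ ↔ p ∈ Ω := fun p ↦ by rw [← hΩΛ]; rfl
  have hmemf : ∀ p, orbitProj G p ∈ frontier Λ ↔ p ∈ frontier Ω := fun p ↦ by rw [← hfr]; rfl
  have hvd : ∀ p ∈ Ω, MDifferentiableAt 𝓘(ℝ, E') 𝓘(ℝ, ℝ) v (orbitProj G p) := fun p hp ↦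
    (hv.contMDiffAt (hΛo.mem_nhds ((hmem p).2 hp))).mdifferentiableAt (by simp)
  have huv' : ∀ p ∈ Ω, u =ᶠ[𝓝 p] v ∘ orbitProj G := fun p hp ↦ by
    filter_upwards [hΩ.isOpen.mem_nhds hp] with y hy using huv y (subset_closure hy)
  -- The identity holds also at critical points, where both fluxes vanish; it is needed near `p`
  -- because divergence and differentiability are local.
  have hflux : ∀ p ∈ Ω, ∀ᶠ y in 𝓝 p,
      fluxField E a u y = horizontalLift E E' (orbitProj G) (fluxField E' a v) y := fun p hp ↦ by
    filter_upwards [hΩ.isOpen.mem_nhds hp] with y hy using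
      fluxField_eq_horizontalLift hA a hfd (hvd y hy) (huv' y hy)
  have hdiff : ∀ p ∈ Ω, MDiffAt (T% (fluxField E a u)) p ↔
      MDiffAt (T% (fluxField E' a v)) (orbitProj G p) := fun p hp ↦
    (mdifferentiableAt_section_congr (hflux p hp)).trans
      (mdifferentiableAt_horizontalLift_iff hf hA (hπ.isSubmersion.isSubmersionAt p))
  -- The drift term is the mean curvature term of the divergence formula, with the scalar factor of
  -- the flux pulled out of the inner product.
  have hdiv : ∀ p ∈ Ω, MDiffAt (T% (fluxField E a u)) p → riemDiv E (fluxField E a u) p =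
      riemDiv E' (fluxField E' a v) (orbitProj G p)
        - a ‖riemGrad E' v (orbitProj G p)‖ / ‖riemGrad E' v (orbitProj G p)‖
          * inner ℝ (riemGrad E' v (orbitProj G p)) (J (orbitProj G p)) := fun p hp hd ↦ by
    rw [riemDiv_congr hd (hflux p hp),
      riemDiv_horizontalLift hf hA ((hdiff p hp).1 hd), ← hH, hJ, fluxField, real_inner_smul_left]
  refine ⟨J, hJ, fun p hp ↦ by rw [norm_riemGrad_eq hA hfd (hvd p hp) (huv' p hp)],
    fun h ↦ ⟨?_, ?_, ?_⟩, fun h ↦ ⟨?_, ?_, ?_⟩⟩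
  · rintro q hqΛ
    obtain ⟨p, rfl⟩ := hq.surjective q
    have hp := (hmem p).1 hqΛ
    exact (hdiff p hp).1 (h.differentiable p hp)
  · rintro q hqΛ
    obtain ⟨p, rfl⟩ := hq.surjective q
    have hp := (hmem p).1 hqΛ
    rw [← hdiv p hp (h.differentiable p hp)]
    exact h.equation p hp
  · rintro q hqΛ
    obtain ⟨p, rfl⟩ := hq.surjective q
    have hp := (hmemf p).1 hqΛ
    rw [← huv p (frontier_subset_closure hp), ← hφψ p hp]
    exact h.boundary p hp
  · exact fun p hp ↦ (hdiff p hp).2 (h.differentiable _ ((hmem p).2 hp))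
  · intro p hp
    have hpΛ := (hmem p).2 hp
    rw [hdiv p hp ((hdiff p hp).2 (h.differentiable _ hpΛ))]
    exact h.equation _ hpΛ
  · intro p hp
    rw [huv p (frontier_subset_closure hp), hφψ p hp]
    exact h.boundary _ ((hmemf p).2 hp)
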